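/- Let $s\ge 1$ and $d_1,\dots,d_s\ge 2$ be integers, let $$R=\mathbb Z[x_1,\dots,x_s]/(x_1^{d_1}+\cdots+x_s^{d_s}),$$ and let $\mathfrak m=(x_1,\dots,x_s)\subset R$ be the homogeneous ideal generated by the variables. For a prime $p$ put $R_p=R/pR$, $\mathfrak m_p=\mathfrak mR_p$ and $d=\dim R_p=s-1$. For $q=p^n$ let $\mathfrak m_p^{[q]}$ be the ideal generated by the $q$-th powers of the elements of $\mathfrak m_p$, and let $\ell$ denote length. Define $$e_{\mathrm{HK}}(\mathfrak m_p,R_p)=\lim_{n\to\infty}\frac{\ell(R_p/\mathfrak m_p^{[p^n]})}{(p^n)^d},\qquad e_{\mathrm{HK}}^{\infty}(\mathfrak m,R)=\lim_{p\to\infty}e_{\mathrm{HK}}(\mathfrak m_p,R_p),$$ where $p$ runs through the primes. Then all these lengths are finite, $\ell(R_p/\mathfrak m_p)\neq 0$ for almost all $p$, the limit $e_{\mathrm{HK}}(\mathfrak m_p,R_p)$ exists for every prime $p$, the limit $e_{\mathrm{HK}}^{\infty}(\mathfrak m,R)$ exists, and for every fixed $n\ge 1$, as $p\to\infty$ through the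 primes, $$e_{\mathrm{HK}}^{\infty}(\mathfrak m,R)=e_{\mathrm{HK}}(\mathfrak m_p,R_p)+O\!\left(\tfrac1p\right)=\frac{\ell(R_p/\mathfrak m_p^{[p^n]})}{(p^n)^d}+O\!\left(\tfrac1p\right).$$ Furthermore, $$e_{\mathrm{HK}}^{\infty}(\mathfrak m,R)=d_1\cdots d_s\; g\!\left(\tfrac1{d_1},\dots,\tfrac1{d_s}\right),$$ where, for $x_1,\dots,x_s\in[0,1]$, $$g(x_1,\dots,x_s)=\frac{1}{2^{s-1}(s-1)!}\sum_{\lambda\in\mathbb Z}\ \sum_{\substack{\epsilon_1,\dots,\epsilon_s\in\{1,-1\}\\ \epsilon_1x_1+\cdots+\epsilon_sx_s\ge 2\lambda}}\epsilon_1\cdots\epsilon_s\,(\epsilon_1x_1+\cdots+\epsilon_sx_s-2\lambda)^{s-1};$$ only finitely many $\lambda$ contribute a nonzero inner sum. -/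

import Mathlib

open Filter Topology Asymptotics

noncomputable section

namespace HilbertKunz

/-- The bracket power `I^{[q]}`: the ideal generated by the `q`-th powers of the elements of `I`.
In characteristic `p`, for `q = p ^ n` and `I = (f₁, …, fᵣ)`, it is `(f₁ ^ q, …, fᵣ ^ q)`. -/
def bracketPower {A : Type*} [CommRing A] (I : Ideal A) (q : ℕ) : Ideal A :=
  Ideal.span ((fun a : A => a ^ q) '' (I : Set A))

/-- The length of the `A`-module `A ⧸ I`. -/
def colength {A : Type*} [CommRing A] (I : Ideal A) : ℕ∞ :=
  Module.length A (A ⧸ I)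

/-- The Krull dimension as a natural number (for nonzero rings of finite dimension). -/
def dimNat (A : Type*) [CommRing A] : ℕ :=
  ((ringKrullDim A).unbotD 0).toNat

/-- The normalized length `ℓ(A / I^{[p^n]}) / (p^n)^{dim A}`. -/
def normalizedColength (p : ℕ) {A : Type*} [CommRing A] (I : Ideal A) (n : ℕ) : ℝ :=
  ((colength (bracketPower I (p ^ n))).toNat : ℝ) / ((p : ℝ) ^ n) ^ dimNat A

/-- The Hilbert–Kunz multiplicity `e_HK(I, A)` of an ideal in a ring of characteristic `p`
(meaningful when `HasHKMultiplicity p I`). -/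
def hkMultiplicity (p : ℕ) {A : Type*} [CommRing A] (I : Ideal A) : ℝ :=
  limUnder atTop (normalizedColength p I)

/-- All the lengths in the definition of the Hilbert–Kunz multiplicity are finite, and the limit
that defines it exists. -/
def HasHKMultiplicity (p : ℕ) {A : Type*} [CommRing A] (I : Ideal A) : Prop :=
  (∀ n : ℕ, colength (bracketPower I (p ^ n)) ≠ ⊤) ∧
    Tendsto (normalizedColength p I) atTop (𝓝 (hkMultiplicity p I))

/-- The reduction `R_p = R / pR`. -/
abbrev Reduction (R : Type*) [CommRing R] (p : ℕ) : Type _ :=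
  R ⧸ Ideal.span {(p : R)}

/-- The extension `I_p = I R_p` of an ideal to the reduction. -/
def reduceIdeal {R : Type*} [CommRing R] (I : Ideal R) (p : ℕ) : Ideal (Reduction R p) :=
  I.map (Ideal.Quotient.mk (Ideal.span {(p : R)}))

/-- The filter "`p → ∞` through the primes". -/
def primesAtTop : Filter ℕ := atTop ⊓ 𝓟 {p : ℕ | p.Prime}

/-- `L` is the limit Hilbert–Kunz multiplicity of `I`: for almost all primes `p` the length of
`R_p / I_p` is finite and nonzero and `e_HK(I_p, R_p)` exists, and `e_HK(I_p, R_p) → L`. -/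
def IsLimitHKMultiplicity {R : Type*} [CommRing R] (I : Ideal R) (L : ℝ) : Prop :=
  (∀ᶠ p in primesAtTop, colength (reduceIdeal I p) ≠ ⊤ ∧ colength (reduceIdeal I p) ≠ 0) ∧
    (∀ᶠ p in primesAtTop, HasHKMultiplicity p (reduceIdeal I p)) ∧
    Tendsto (fun p : ℕ => hkMultiplicity p (reduceIdeal I p)) primesAtTop (𝓝 L)

/-- The diagonal hypersurface ring `ℤ[x₁, …, xₛ] / (x₁ ^ d₁ + ⋯ + xₛ ^ dₛ)`. -/
abbrev DiagonalRing {s : ℕ} (d : Fin s → ℕ) : Type :=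
  MvPolynomial (Fin s) ℤ ⧸
    Ideal.span {∑ i, (MvPolynomial.X i : MvPolynomial (Fin s) ℤ) ^ d i}

/-- The homogeneous ideal of the diagonal hypersurface ring generated by the variables. -/
def varIdeal {s : ℕ} (d : Fin s → ℕ) : Ideal (DiagonalRing d) :=
  Ideal.span (Set.range fun i : Fin s =>
    (Ideal.Quotient.mk _ (MvPolynomial.X i) : DiagonalRing d))

/-- `g_λ(x) = ∑ ε₁⋯εₛ (ε₁ x₁ + ⋯ + εₛ xₛ - 2λ)^(s-1)`, the sum over the signs `ε` with
`ε₁ x₁ + ⋯ + εₛ xₛ ≥ 2λ`. -/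
def gTerm {s : ℕ} (x : Fin s → ℝ) (l : ℤ) : ℝ :=
  ∑ ε : Fin s → ℤˣ with 2 * (l : ℝ) ≤ ∑ i, ((ε i : ℤ) : ℝ) * x i,
    (∏ i, ((ε i : ℤ) : ℝ)) * (∑ i, ((ε i : ℤ) : ℝ) * x i - 2 * (l : ℝ)) ^ (s - 1)

/-- `g(x) = (2^(s-1) (s-1)!)⁻¹ ∑_{λ ∈ ℤ} g_λ(x)`; only finitely many `g_λ(x)` are nonzero. -/
def g {s : ℕ} (x : Fin s → ℝ) : ℝ :=
  1 / (2 ^ (s - 1) * ((s - 1).factorial : ℝ)) * ∑ᶠ l : ℤ, gTerm x l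

end HilbertKunz

end

/-! Over a field K of characteristic p let D(a) be the dimension of K[x]/(x_i^{a_i}, ∑ x_i).
Substituting x_i^{d_i} for x_i multiplies dimensions by d_1⋯d_s (`diagDim_mul`), so the length of
R_p/𝔪_p^{[q]} lies between the values of d_1⋯d_s·D(a) at a_i = ⌊q/d_i⌋ and at a_i = ⌊q/d_i⌋ + 1. For
s = 1 the lengths equal d_1 as soon as q ≥ d_1. For s ≥ 2 two facts about D are combined.

Existence of the limits: D(pa) = p^{s-1} D(a) by Frobenius (`diagDim_frobenius`), and raising one
exponent by one costs at most M^{s-2} if all exponents are at most M (`diagDim_le_add`). Hence the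
normalized lengths at p^m and p^{m+1} differ by at most C/p^m with C independent of p
(`exists_abs_diagRatio_succ_sub_le`). They converge geometrically, and every term with m ≥ 1 is
within O(1/p) of the limit.

Value of the limit: for exponents at most p, D is known exactly. Eliminating a variable turns D into
the dimension of K[x]/(x_i^{a_i}, (∑ x_i)^b), which satisfies a discrete wave equation in b and one
exponent (`splitDim_wave`), a consequence of an involution of the dual numbers. The boundary values
at b = 0 and b = p then force it to be an iterated box sum of a staircase jumping at the multiples
of 2p (`splitDim_eq_boxIter`). The staircase is a superposition of unit steps placed at 2pλ, and
iterated box sums of a unit step are alternating sums of truncated powers up to lower order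
(`exists_abs_boxIter_sub_signSum_le`). Summing over λ gives D(a) = p^{s-1} g(a/p) + O(p^{s-2})
(`exists_abs_linNat_sub_le`), and a_i ≈ p/d_i yields the formula already at q = p. -/

noncomputable section

namespace HilbertKunz

/-! ### Dimensions of quotient algebras over a field. -/

section Length

variable {K : Type*} [Field K] {A B : Type*} [CommRing A] [Algebra K A] [CommRing B] [Algebra K B]

/-- The dimension over `K` of `A ⧸ I`, as an extended natural number. -/
def quotDim (K : Type*) [Field K] {A : Type*} [CommRing A] [Algebra K A] (I : Ideal A) : ℕ∞ :=
  Module.length K (A ⧸ I)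

lemma quotDim_anti {I J : Ideal A} (h : I ≤ J) : quotDim K J ≤ quotDim K I :=
  Module.length_le_of_surjective (Ideal.Quotient.factorₐ K h).toLinearMap
    (Ideal.Quotient.factor_surjective h)

@[simp]
lemma quotDim_top : quotDim K (⊤ : Ideal A) = 0 :=
  have : Subsingleton (A ⧸ (⊤ : Ideal A)) := Ideal.Quotient.subsingleton_iff.2 rfl
  Module.length_eq_zero

lemma quotDim_eq_length_of_ker_eq {M : Type*} [AddCommGroup M] [Module K M] (I : Ideal A)
    (f : A →ₗ[K] M) (hf : Function.Surjective f) (hk : ∀ x, f x = 0 ↔ x ∈ I) :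
    quotDim K I = Module.length K M := by
  have e := f.quotKerEquivOfSurjective hf
  have hker : LinearMap.ker f = I.restrictScalars K := by
    ext x
    simp [hk]
  rw [← e.length_eq, hker]
  rfl

lemma quotDim_map_of_surjective (φ : A →ₐ[K] B) (hφ : Function.Surjective φ) (I : Ideal A)
    (hI : ∀ x, φ x = 0 → x ∈ I) : quotDim K (I.map φ) = quotDim K I := by
  refine (quotDim_eq_length_of_ker_eq I
    ((Ideal.Quotient.mkₐ K (I.map φ)).comp φ).toLinearMap
    ((Ideal.Quotient.mk_surjective).comp hφ) fun x => ?_).symm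
  have : ((Ideal.Quotient.mkₐ K (I.map φ)).comp φ).toLinearMap x = 0 ↔ φ x ∈ I.map φ := by
    simp [Ideal.Quotient.eq_zero_iff_mem]
  rw [this]
  refine ⟨fun h => ?_, fun h => Ideal.mem_map_of_mem φ h⟩
  obtain ⟨y, hy, hyx⟩ := (Ideal.mem_map_iff_of_surjective φ hφ).1 h
  have := I.add_mem hy (hI (x - y) (by simp [hyx]))
  simpa using this

/-- Multiplication by x maps A/(J + (y)) onto the kernel of A/(J + (xy)) → A/(J + (x)). -/
lemma quotDim_sup_span_mul_le (J : Ideal A) (x y : A) :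
    quotDim K (J ⊔ Ideal.span {x * y}) ≤
      quotDim K (J ⊔ Ideal.span {x}) + quotDim K (J ⊔ Ideal.span {y}) := by
  have hxy : J ⊔ Ideal.span {x * y} ≤ J ⊔ Ideal.span {x} :=
    sup_le_sup_left (Ideal.span_singleton_le_span_singleton.2 (dvd_mul_right x y)) J
  let g := (Ideal.Quotient.factorₐ K hxy).toLinearMap
  have hg : Function.Surjective g := Ideal.Quotient.factor_surjective hxy
  let f : A →ₗ[K] A ⧸ (J ⊔ Ideal.span {x * y}) :=
    (Ideal.Quotient.mkₐ K _).toLinearMap ∘ₗ LinearMap.mulLeft K x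
  have hf : (J ⊔ Ideal.span {y}).restrictScalars K ≤ LinearMap.ker f := by
    intro z hz
    obtain ⟨j, hj, w, hw, rfl⟩ := Submodule.mem_sup.1 hz
    obtain ⟨c, rfl⟩ := Ideal.mem_span_singleton'.1 hw
    have : x * (j + c * y) ∈ J ⊔ Ideal.span {x * y} := by
      rw [mul_add]
      refine Ideal.add_mem _ (Ideal.mem_sup_left (J.mul_mem_left _ hj)) (Ideal.mem_sup_right ?_)
      exact Ideal.mem_span_singleton'.2 ⟨c, by ring⟩
    exact Ideal.Quotient.eq_zero_iff_mem.2 this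
  have hker : Module.length K (LinearMap.ker g) ≤ quotDim K (J ⊔ Ideal.span {y}) := by
    have hfg : ∀ z, f z ∈ LinearMap.ker g := by
      intro z
      have : x * z ∈ J ⊔ Ideal.span {x} :=
        Ideal.mem_sup_right (Ideal.mem_span_singleton'.2 ⟨z, mul_comm _ _⟩)
      simpa [f, g, Ideal.Quotient.eq_zero_iff_mem] using
        (Ideal.Quotient.eq_zero_iff_mem.2 this)
    let f' := f.codRestrict (LinearMap.ker g) hfg
    have hf' : (J ⊔ Ideal.span {y}).restrictScalars K ≤ LinearMap.ker f' := by
      rwa [LinearMap.ker_codRestrict]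
    refine Module.length_le_of_surjective
      (((J ⊔ Ideal.span {y}).restrictScalars K).liftQ f' hf') ?_
    rintro ⟨z, hz⟩
    obtain ⟨z, rfl⟩ := Ideal.Quotient.mk_surjective z
    have hz' : z ∈ J ⊔ Ideal.span {x} := Ideal.Quotient.eq_zero_iff_mem.1 hz
    obtain ⟨j, hj, w, hw, rfl⟩ := Submodule.mem_sup.1 hz'
    obtain ⟨c, rfl⟩ := Ideal.mem_span_singleton'.1 hw
    refine ⟨Submodule.Quotient.mk c, Subtype.ext ?_⟩
    change Ideal.Quotient.mk _ (x * c) = Ideal.Quotient.mk _ (j + c * x)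
    rw [Ideal.Quotient.eq]
    have := Ideal.mem_sup_left (T := Ideal.span {x * y}) (J.neg_mem hj)
    convert this using 1
    ring
  have := Module.length_eq_add_of_exact (LinearMap.ker g).subtype g
    (Submodule.subtype_injective _) hg (LinearMap.exact_subtype_ker_map g)
  calc quotDim K (J ⊔ Ideal.span {x * y})
      = Module.length K (LinearMap.ker g) + quotDim K (J ⊔ Ideal.span {x}) := this
    _ ≤ quotDim K (J ⊔ Ideal.span {y}) + quotDim K (J ⊔ Ideal.span {x}) := by gcongr
    _ = _ := add_comm _ _

/-- If `B` is free over `A` via `φ`, with coordinates `r` with respect to `b`, then the dimension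
of `B ⧸ I B` is a multiple of that of `A ⧸ I`. -/
lemma quotDim_map_of_coordinates {ι : Type*} [Fintype ι] (φ : A →ₐ[K] B) (b : ι → B)
    (r : B →ₗ[K] (ι → A)) (hr : ∀ x c, r (φ x * c) = x • r c)
    (hb : ∀ c, ∑ i, φ (r c i) * b i = c) (hrs : Function.Surjective r) (I : Ideal A) :
    quotDim K (I.map φ) = Fintype.card ι * quotDim K I := by
  let π : (ι → A) →ₗ[K] (ι → A ⧸ I) :=
    LinearMap.pi fun i => (Ideal.Quotient.mkₐ K I).toLinearMap ∘ₗ LinearMap.proj i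
  have hπ : Function.Surjective π := by
    intro y
    choose x hx using fun i => Ideal.Quotient.mk_surjective (I := I) (y i)
    exact ⟨x, funext hx⟩
  rw [quotDim_eq_length_of_ker_eq (I.map φ) (π ∘ₗ r) (hπ.comp hrs)]
  · rw [Module.length_pi_of_fintype]
    simp [quotDim]
  intro c
  have hc : (π ∘ₗ r) c = 0 ↔ ∀ i, r c i ∈ I := by
    simp [π, funext_iff, Ideal.Quotient.eq_zero_iff_mem]
  rw [hc]
  constructor
  · intro h
    rw [← hb c]
    exact Ideal.sum_mem _ fun i _ => Ideal.mul_mem_right _ _ (Ideal.mem_map_of_mem φ (h i))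
  · intro h
    refine Submodule.span_induction (p := fun c _ => ∀ i, r c i ∈ I) ?_ ?_ ?_ ?_ h
    · rintro _ ⟨x, hx, rfl⟩ i
      have : φ x = φ x * 1 := (mul_one _).symm
      rw [this, hr]
      exact I.mul_mem_right _ hx
    · simp
    · intro x y _ _ hx hy i
      simpa using I.add_mem (hx i) (hy i)
    · intro a x _ hx i
      -- The coordinates are linear only over A, so a multiple by a general element of B is handled
      -- by expanding x in the generators b.
      rw [← hb x, smul_eq_mul, Finset.mul_sum]
      simp_rw [mul_left_comm a, map_sum, hr, Finset.sum_apply, Pi.smul_apply, smul_eq_mul]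
      exact Ideal.sum_mem _ fun j _ => I.mul_mem_right _ (hx j)

end Length

/-! ### The wave equation from an involution of the dual numbers. -/

section DualNumber

open scoped DualNumber
open TrivSqZeroExt

variable {K : Type*} [Field K] {A : Type*} [CommRing A] [Algebra K A]

lemma dualNumber_inl_add_eps_pow (f : A) (j : ℕ) :
    (inl f + DualNumber.eps : A[ε]) ^ (j + 1) = inl (f ^ (j + 1)) + inr ((j + 1) * f ^ j) := by
  induction j with
  | zero => ext <;> simp
  | succ j ih =>
    rw [pow_succ, ih]
    ext
    · simp [pow_succ]
    · simp
      ring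

/-- The ideal of the dual numbers generated by `J` and `(f + ε) ^ j`. -/
def shiftIdeal (J : Ideal A) (f : A) (j : ℕ) : Ideal A[ε] :=
  J.map (inlHom A A) ⊔ Ideal.span {(inl f + DualNumber.eps) ^ j}

lemma inr_mem_map_inlHom {J : Ideal A} {x : A} (hx : x ∈ J) :
    (inr x : A[ε]) ∈ J.map (inlHom A A) := by
  have : (inr x : A[ε]) = DualNumber.eps * inlHom A A x := by
    ext <;> simp
  rw [this]
  exact Ideal.mul_mem_left _ _ (Ideal.mem_map_of_mem _ hx)

lemma mem_shiftIdeal_iff (J : Ideal A) (f : A) (j : ℕ) {u : A} (hu : u * (j + 1) = 1)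
    (z : A[ε]) :
    z ∈ shiftIdeal J f (j + 1) ↔
      (j + 1) * z.fst - f * z.snd ∈ J ⊔ Ideal.span {f ^ (j + 2)} ∧
        z.snd ∈ J ⊔ Ideal.span {f ^ j} := by
  constructor
  · intro hz
    obtain ⟨x, hx, y, hy, rfl⟩ := Submodule.mem_sup.1 hz
    obtain ⟨c, rfl⟩ := Ideal.mem_span_singleton'.1 hy
    have hxJ : x.fst ∈ J ∧ x.snd ∈ J := by
      refine Submodule.span_induction (p := fun x _ => x.fst ∈ J ∧ x.snd ∈ J) ?_ ?_ ?_ ?_ hx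
      · rintro _ ⟨x, hx, rfl⟩
        simpa using hx
      · simp
      · intro x y _ _ hx hy
        exact ⟨J.add_mem hx.1 hy.1, J.add_mem hx.2 hy.2⟩
      · intro a x _ hx
        refine ⟨by simpa using J.mul_mem_left _ hx.1, ?_⟩
        simpa [mul_comm] using J.add_mem (J.mul_mem_left a.fst hx.2) (J.mul_mem_left a.snd hx.1)
    rw [dualNumber_inl_add_eps_pow]
    constructor
    · refine Submodule.mem_sup.2 ⟨(j + 1) * x.fst - f * x.snd,
        J.sub_mem (J.mul_mem_left _ hxJ.1) (J.mul_mem_left _ hxJ.2), -c.snd * f ^ (j + 2),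
        Ideal.mem_span_singleton'.2 ⟨_, rfl⟩, ?_⟩
      simp
      ring
    · refine Submodule.mem_sup.2 ⟨x.snd, hxJ.2, (c.fst * (j + 1) + c.snd * f) * f ^ j,
        Ideal.mem_span_singleton'.2 ⟨_, rfl⟩, ?_⟩
      simp
      ring
  · rintro ⟨h₁, h₂⟩
    obtain ⟨u₂, hu₂, y, hy, hx⟩ := Submodule.mem_sup.1 h₁
    obtain ⟨t, rfl⟩ := Ideal.mem_span_singleton'.1 hy
    obtain ⟨u₁, hu₁, y, hy, hz⟩ := Submodule.mem_sup.1 h₂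
    obtain ⟨r, rfl⟩ := Ideal.mem_span_singleton'.1 hy
    have hfst : z.fst = u * (f * u₁ + u₂) + u * (r * f ^ (j + 1) + t * f ^ (j + 2)) := by
      calc z.fst = u * (j + 1) * z.fst := by rw [hu, one_mul]
        _ = u * (((j + 1) * z.fst - f * z.snd) + f * z.snd) := by ring
        _ = _ := by rw [← hx, ← hz]; ring
    -- The factor f - (j+1)ε is chosen so that its product with (f + ε)^(j+1) is f^(j+2), with no
    -- ε-part.
    have key : z = (inlHom A A (u * (f * u₁ + u₂)) + inr u₁) +
        (inl (u * r) + inl (u * t) * (inl f - inr (j + 1 : A))) *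
          (inl f + DualNumber.eps) ^ (j + 1) := by
      rw [dualNumber_inl_add_eps_pow]
      ext
      · simp [hfst]
        ring
      · simp [← hz]
        linear_combination (- r * f ^ j) * hu
    rw [key]
    refine Ideal.add_mem _ (Ideal.mem_sup_left (Ideal.add_mem _ (Ideal.mem_map_of_mem _ ?_)
      (inr_mem_map_inlHom hu₁))) (Ideal.mem_sup_right (Ideal.mem_span_singleton'.2 ⟨_, rfl⟩))
    exact J.mul_mem_left _ (J.add_mem (J.mul_mem_left _ hu₁) hu₂)

/-- Since j + 1 is invertible, x + yε ↦ ((j+1)x - fy, y) is a linear change of coordinates; by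
`mem_shiftIdeal_iff` it splits the ideal into a product of two ideals of A. -/
lemma quotDim_shiftIdeal (J : Ideal A) (f : A) (j : ℕ) (hj : ((j + 1 : ℕ) : K) ≠ 0) :
    quotDim K (shiftIdeal J f (j + 1)) =
      quotDim K (J ⊔ Ideal.span {f ^ (j + 2)}) + quotDim K (J ⊔ Ideal.span {f ^ j}) := by
  have hu : algebraMap K A ((j + 1 : ℕ) : K)⁻¹ * (j + 1) = 1 := by
    have := congrArg (algebraMap K A) (inv_mul_cancel₀ hj)
    rw [map_mul, map_natCast, map_one] at this
    rw [← Nat.cast_add_one]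
    exact this
  set u := algebraMap K A ((j + 1 : ℕ) : K)⁻¹
  let F : A[ε] →ₗ[K] A := LinearMap.mulLeft K ((j : A) + 1) ∘ₗ (fstHom K A A).toLinearMap -
      LinearMap.mulLeft K f ∘ₗ (sndHom A A).restrictScalars K
  have hF : ∀ z, F z = (j + 1) * z.fst - f * z.snd := fun z => rfl
  let ψ := ((Ideal.Quotient.mkₐ K (J ⊔ Ideal.span {f ^ (j + 2)})).toLinearMap ∘ₗ F).prod
    ((Ideal.Quotient.mkₐ K (J ⊔ Ideal.span {f ^ j})).toLinearMap ∘ₗ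
      (sndHom A A).restrictScalars K)
  have hψ : ∀ z, ψ z = (Ideal.Quotient.mk _ ((j + 1) * z.fst - f * z.snd),
    Ideal.Quotient.mk _ z.snd) := fun z => rfl
  rw [quotDim_eq_length_of_ker_eq _ ψ, Module.length_prod]
  · rfl
  · rintro ⟨x, y⟩
    obtain ⟨x, rfl⟩ := Ideal.Quotient.mk_surjective x
    obtain ⟨y, rfl⟩ := Ideal.Quotient.mk_surjective y
    refine ⟨inl (u * (x + f * y)) + inr y, ?_⟩
    rw [hψ]
    have : ((j : A) + 1) * (u * (x + f * y)) - f * y = x := by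
      linear_combination (x + f * y) * hu
    simp [this]
  · intro z
    rw [hψ, mem_shiftIdeal_iff J f j hu, Prod.mk_eq_zero, Ideal.Quotient.eq_zero_iff_mem,
      Ideal.Quotient.eq_zero_iff_mem]

/-- The involution `x + y ε ↦ x + (δ x - y) ε` of the dual numbers. -/
def derivInvolution (δ : Derivation K A A) : A[ε] →ₐ[K] A[ε] :=
  AlgHom.ofLinearMap
    { toFun := fun z => inl z.fst + inr (δ z.fst - z.snd)
      map_add' := fun x y => by ext <;> simp; ring
      map_smul' := fun c x => by ext <;> simp [smul_sub] }
    (by ext <;> simp) (fun x y => by ext <;> simp; ring)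

lemma derivInvolution_apply (δ : Derivation K A A) (z : A[ε]) :
    derivInvolution δ z = inl z.fst + inr (δ z.fst - z.snd) := rfl

lemma derivInvolution_derivInvolution (δ : Derivation K A A) (z : A[ε]) :
    derivInvolution δ (derivInvolution δ z) = z := by
  ext <;> simp [derivInvolution_apply]

/-- As δ f = δ g = 1, `derivInvolution` sends f + ε to f and g to g + ε, and it preserves the
extension of the δ-stable ideal J. The shift thus moves from f to g. -/
lemma quotDim_shiftIdeal_symm (δ : Derivation K A A) (J : Ideal A) (hJ : ∀ x ∈ J, δ x ∈ J)
    (f g : A) (hf : δ f = 1) (hg : δ g = 1) (a b : ℕ) :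
    quotDim K (shiftIdeal (J ⊔ Ideal.span {g ^ b}) f a) =
      quotDim K (shiftIdeal (J ⊔ Ideal.span {f ^ a}) g b) := by
  let τ := derivInvolution δ
  have hτ : Function.Involutive τ := derivInvolution_derivInvolution δ
  have key : ∀ (f g : A) (_ : δ f = 1) (_ : δ g = 1) (a b : ℕ),
      (shiftIdeal (J ⊔ Ideal.span {g ^ b}) f a).map τ ≤
        shiftIdeal (J ⊔ Ideal.span {f ^ a}) g b := by
    intro f g hf hg a b
    have h₁ : τ (inl g) = inl g + DualNumber.eps := by
      ext <;> simp [τ, derivInvolution_apply, hg]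
    have h₂ : τ (inl f + DualNumber.eps) = inl f := by
      ext <;> simp [τ, derivInvolution_apply, hf]
    rw [shiftIdeal, Ideal.map_le_iff_le_comap, Ideal.map_sup]
    refine sup_le (sup_le (Ideal.map_le_iff_le_comap.2 fun x hx => ?_)
      (Ideal.map_le_iff_le_comap.2 ?_)) ?_
    · refine Ideal.mem_sup_left ?_
      have : τ (inlHom A A x) = inlHom A A x + inr (δ x) := by
        ext <;> simp [τ, derivInvolution_apply]
      rw [this]
      exact Ideal.add_mem _ (Ideal.mem_map_of_mem _ (Ideal.mem_sup_left hx))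
        (inr_mem_map_inlHom (Ideal.mem_sup_left (hJ x hx)))
    · rw [Ideal.span_singleton_le_iff_mem, Ideal.mem_comap, Ideal.mem_comap, inlHom_apply,
        ← inl_pow, map_pow, h₁]
      exact Ideal.mem_sup_right (Ideal.mem_span_singleton_self _)
    · rw [Ideal.span_singleton_le_iff_mem, Ideal.mem_comap, map_pow, h₂, inl_pow,
        ← inlHom_apply]
      exact Ideal.mem_sup_left (Ideal.mem_map_of_mem _
        (Ideal.mem_sup_right (Ideal.mem_span_singleton_self _)))
  have hinj : ∀ x, τ x = 0 → x ∈ shiftIdeal (J ⊔ Ideal.span {g ^ b}) f a := fun x hx => by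
    have : x = 0 := by rw [← hτ x, hx, map_zero]
    simp [this]
  rw [← quotDim_map_of_surjective τ hτ.surjective _ hinj]
  congr 1
  refine le_antisymm (key f g hf hg a b) fun x hx => ?_
  rw [← hτ x]
  exact Ideal.mem_map_of_mem τ (key g f hg hf b a (Ideal.mem_map_of_mem τ hx))

/-- The discrete wave equation for the colengths of the ideals `J + (f ^ a, g ^ b)`. -/
theorem quotDim_wave (δ : Derivation K A A) (J : Ideal A) (hJ : ∀ x ∈ J, δ x ∈ J)
    (f g : A) (hf : δ f = 1) (hg : δ g = 1) (a b : ℕ) (ha : ((a + 1 : ℕ) : K) ≠ 0)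
    (hb : ((b + 1 : ℕ) : K) ≠ 0) :
    quotDim K (J ⊔ Ideal.span {g ^ (b + 1)} ⊔ Ideal.span {f ^ (a + 2)}) +
        quotDim K (J ⊔ Ideal.span {g ^ (b + 1)} ⊔ Ideal.span {f ^ a}) =
      quotDim K (J ⊔ Ideal.span {f ^ (a + 1)} ⊔ Ideal.span {g ^ (b + 2)}) +
        quotDim K (J ⊔ Ideal.span {f ^ (a + 1)} ⊔ Ideal.span {g ^ b}) := by
  rw [← quotDim_shiftIdeal _ _ _ ha, ← quotDim_shiftIdeal _ _ _ hb,
    quotDim_shiftIdeal_symm δ J hJ f g hf hg]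

end DualNumber

/-! ### Substituting powers of the variables. -/

section Subst

open MvPolynomial

variable {K : Type*} [Field K] {n : ℕ}

/-- The substitution `x_i ↦ x_i ^ c_i`. -/
def substPow (K : Type*) [Field K] {n : ℕ} (c : Fin n → ℕ) :
    MvPolynomial (Fin n) K →ₐ[K] MvPolynomial (Fin n) K :=
  aeval fun i => X i ^ c i

@[simp]
lemma substPow_X (c : Fin n → ℕ) (i : Fin n) : substPow K c (X i) = X i ^ c i := by
  simp [substPow]

/-- The exponent vector given by a function. -/
abbrev expVec (m : Fin n → ℕ) : Fin n →₀ ℕ := Finsupp.equivFunOnFinite.symm m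

lemma substPow_monomial (c : Fin n → ℕ) (m : Fin n →₀ ℕ) (k : K) :
    substPow K c (monomial m k) = monomial (expVec fun i => c i * m i) k := by
  rw [substPow, aeval_monomial, monomial_eq, algebraMap_eq,
    Finsupp.prod_fintype _ _ (by simp), Finsupp.prod_fintype _ _ (by simp)]
  simp [pow_mul]

/-- The coordinates of a polynomial with respect to the monomials with exponents less than `c`,
over the subring of polynomials in `x_i ^ c_i`. -/
def powCoord (K : Type*) [Field K] (c : Fin n → ℕ) (hc : ∀ i, 0 < c i) :
    MvPolynomial (Fin n) K →ₗ[K] ((∀ i, Fin (c i)) → MvPolynomial (Fin n) K) :=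
  (basisMonomials (Fin n) K).constr K fun m =>
    Pi.single (fun i => ⟨m i % c i, Nat.mod_lt _ (hc i)⟩)
      (monomial (expVec fun i => m i / c i) 1)

lemma powCoord_monomial (c : Fin n → ℕ) (hc : ∀ i, 0 < c i) (m : Fin n →₀ ℕ) (k : K) :
    powCoord K c hc (monomial m k) = Pi.single (fun i => ⟨m i % c i, Nat.mod_lt _ (hc i)⟩)
      (monomial (expVec fun i => m i / c i) k) := by
  have : monomial m k = k • basisMonomials (Fin n) K m := by
    simp [coe_basisMonomials, smul_monomial]
  rw [this, map_smul, powCoord, Module.Basis.constr_basis, ← Pi.single_smul, smul_monomial]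
  simp

/-- The polynomial ring is free over the subring generated by the x_i^{c_i}, on the ∏ c_i monomials
whose exponents are less than c. -/
lemma quotDim_map_substPow (c : Fin n → ℕ) (hc : ∀ i, 0 < c i)
    (I : Ideal (MvPolynomial (Fin n) K)) :
    quotDim K (I.map (substPow K c)) = (∏ i, c i : ℕ) * quotDim K I := by
  have hmul : ∀ x y, powCoord K c hc (substPow K c x * y) = x • powCoord K c hc y := by
    intro x y
    induction x using MvPolynomial.induction_on' with
    | monomial u k =>
      induction y using MvPolynomial.induction_on' with
      | monomial v l =>
        rw [substPow_monomial, monomial_mul, powCoord_monomial, powCoord_monomial,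
          ← Pi.single_smul, smul_eq_mul, monomial_mul]
        congr 1
        · ext i
          simp
        · refine congrArg (fun w => monomial w (k * l)) (Finsupp.ext fun i => ?_)
          simp [Nat.mul_add_div (hc i)]
      | add p q hp hq => rw [mul_add, map_add, map_add, hp, hq, smul_add]
    | add p q hp hq => rw [map_add, add_mul, map_add, hp, hq, add_smul]
  let b : (∀ i, Fin (c i)) → MvPolynomial (Fin n) K :=
    fun t => monomial (expVec fun i => (t i : ℕ)) 1
  have hb : ∀ y, ∑ t, substPow K c (powCoord K c hc y t) * b t = y := by
    intro y
    induction y using MvPolynomial.induction_on' with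
    | monomial v l =>
      rw [powCoord_monomial, Finset.sum_eq_single fun i => ⟨v i % c i, Nat.mod_lt _ (hc i)⟩]
      · rw [Pi.single_eq_same, substPow_monomial, monomial_mul, mul_one]
        refine congrArg (fun w => monomial w l) (Finsupp.ext fun i => ?_)
        simp [Nat.div_add_mod]
      · intro t _ ht
        simp [Pi.single_eq_of_ne ht]
      · simp
    | add p q hp hq =>
      simp only [map_add, Pi.add_apply, add_mul, Finset.sum_add_distrib, hp, hq]
  have hbs : ∀ t, powCoord K c hc (b t) = Pi.single t 1 := by
    intro t
    rw [powCoord_monomial]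
    congr 1
    · ext i
      simp [Nat.mod_eq_of_lt (t i).2]
    · have : (expVec fun i => (expVec fun i => (t i : ℕ)) i / c i) = 0 := by
        ext i
        simp [Nat.div_eq_of_lt (t i).2]
      rw [this]
      rfl
  rw [quotDim_map_of_coordinates (substPow K c) b (powCoord K c hc) hmul hb]
  · simp
  · intro y
    refine ⟨∑ t, substPow K c (y t) * b t, ?_⟩
    simp_rw [map_sum, hmul, hbs]
    ext1 s
    simp [Finset.sum_apply, Pi.single_apply]

end Subst

/-! ### Eliminating a variable. -/

section Elimination

open MvPolynomial

variable {K : Type*} [Field K] {n : ℕ}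

/-- The substitution `x_0 ↦ v`. -/
def elim (v : MvPolynomial (Fin n) K) : MvPolynomial (Fin (n + 1)) K →ₐ[K] MvPolynomial (Fin n) K :=
  aeval (Fin.cons v X)

@[simp]
lemma elim_X_zero (v : MvPolynomial (Fin n) K) : elim v (X 0) = v := by simp [elim]

@[simp]
lemma elim_X_succ (v : MvPolynomial (Fin n) K) (i : Fin n) : elim v (X i.succ) = X i := by
  simp [elim]

lemma quotDim_map_elim (v : MvPolynomial (Fin n) K) (I : Ideal (MvPolynomial (Fin (n + 1)) K))
    (hI : X 0 - rename Fin.succ v ∈ I) : quotDim K (I.map (elim v)) = quotDim K I := by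
  refine quotDim_map_of_surjective _ (fun f => ⟨rename Fin.succ f, ?_⟩) I fun f hf => ?_
  · have : (elim v).comp (rename Fin.succ) = AlgHom.id K _ := by
      ext i
      simp
    exact DFunLike.congr_fun this f
  · have : (Ideal.Quotient.mkₐ K I).comp ((rename Fin.succ).comp (elim v)) =
        Ideal.Quotient.mkₐ K I := by
      ext i
      refine Fin.cases ?_ (fun i => ?_) i
      · simpa using (Ideal.Quotient.eq.2 hI).symm
      · simp
    have := DFunLike.congr_fun this f
    simp [hf] at this
    exact Ideal.Quotient.eq_zero_iff_mem.1 this.symm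

end Elimination

/-! ### Dimensions attached to diagonal and linear forms. -/

section Diagonal

open MvPolynomial

variable {K : Type*} [Field K] {n : ℕ}

/-- The ideal `(x_i ^ a_i)`. -/
def powIdeal (K : Type*) [Field K] {n : ℕ} (a : Fin n → ℕ) : Ideal (MvPolynomial (Fin n) K) :=
  Ideal.span (Set.range fun i => X i ^ a i)

/-- The dimension of `K[x] / (x_i ^ a_i, ∑ x_i ^ d_i)`. -/
def diagDim (K : Type*) [Field K] {n : ℕ} (a d : Fin n → ℕ) : ℕ∞ :=
  quotDim K (powIdeal K a ⊔ Ideal.span {∑ i, X i ^ d i})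

/-- The dimension of `K[x] / (x_i ^ a_i, (∑ x_i) ^ b)`. -/
def splitDim (K : Type*) [Field K] {n : ℕ} (a : Fin n → ℕ) (b : ℕ) : ℕ∞ :=
  quotDim K (powIdeal K a ⊔ Ideal.span {(∑ i, X i) ^ b})

lemma X_pow_mem_powIdeal {a : Fin n → ℕ} {i : Fin n} {m : ℕ} (h : a i ≤ m) :
    (X i ^ m : MvPolynomial (Fin n) K) ∈ powIdeal K a :=
  (powIdeal K a).pow_mem_of_pow_mem (Ideal.subset_span ⟨i, rfl⟩) h

lemma powIdeal_anti {a a' : Fin n → ℕ} (h : a ≤ a') : powIdeal K a' ≤ powIdeal K a := by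
  refine Ideal.span_le.2 ?_
  rintro _ ⟨i, rfl⟩
  exact X_pow_mem_powIdeal (h i)

lemma powIdeal_eq_top {a : Fin n → ℕ} {i : Fin n} (h : a i = 0) : powIdeal K a = ⊤ := by
  rw [Ideal.eq_top_iff_one]
  simpa using X_pow_mem_powIdeal (K := K) (a := a) (i := i) (m := 0) h.le

lemma powIdeal_cons (b : ℕ) (a : Fin n → ℕ) :
    powIdeal K (Fin.cons b a : Fin (n + 1) → ℕ) =
      Ideal.span (Set.range fun i : Fin n => X i.succ ^ a i) ⊔ Ideal.span {X 0 ^ b} := by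
  rw [powIdeal, ← Ideal.span_union]
  congr 1
  ext x
  simp [Fin.exists_fin_succ, eq_comm]

lemma map_elim_span (v : MvPolynomial (Fin n) K) (a : Fin n → ℕ) :
    (Ideal.span (Set.range fun i : Fin n => (X i.succ ^ a i : MvPolynomial _ K))).map (elim v) =
      powIdeal K a := by
  rw [Ideal.map_span, ← Set.range_comp, powIdeal]
  congr 2
  ext1 i
  simp

lemma diagDim_mono {a a' : Fin n → ℕ} (h : a ≤ a') (d : Fin n → ℕ) :
    diagDim K a d ≤ diagDim K a' d :=
  quotDim_anti (sup_le_sup_right (powIdeal_anti h) _)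

lemma splitDim_zero (a : Fin n → ℕ) : splitDim K a 0 = 0 := by
  have : powIdeal K a ⊔ Ideal.span {(∑ i, X i) ^ 0} = ⊤ := by simp
  rw [splitDim, this, quotDim_top]

lemma splitDim_eq_zero {a : Fin n → ℕ} {i : Fin n} (h : a i = 0) (b : ℕ) :
    splitDim K a b = 0 := by
  rw [splitDim, powIdeal_eq_top h, top_sup_eq, quotDim_top]

lemma splitDim_one (a : Fin n → ℕ) : splitDim K a 1 = diagDim K a 1 := by
  simp [splitDim, diagDim]

/-- The linear relation gives x_0 = -∑ x_i, so x_0^b becomes (∑ x_i)^b up to a unit. -/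
lemma diagDim_cons (b : ℕ) (a : Fin n → ℕ) :
    diagDim K (Fin.cons b a : Fin (n + 1) → ℕ) 1 = splitDim K a b := by
  rw [diagDim, ← quotDim_map_elim (-∑ i, X i), powIdeal_cons, Ideal.map_sup, Ideal.map_sup,
    map_elim_span, Ideal.map_span, Ideal.map_span, splitDim]
  · have h₁ : (elim (-∑ i, X i) : MvPolynomial (Fin (n + 1)) K →ₐ[K] _)
        (∑ i, X i ^ (1 : Fin (n + 1) → ℕ) i) = 0 := by
      simp [Fin.sum_univ_succ]
    rw [Set.image_singleton, Set.image_singleton, h₁, Ideal.span_singleton_eq_bot.2 rfl,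
      sup_bot_eq, map_pow, elim_X_zero, neg_pow, Ideal.span_singleton_mul_left_unit]
    exact isUnit_one.neg.pow b
  · refine Ideal.mem_sup_right ?_
    simp [Fin.sum_univ_succ]

lemma splitDim_cons_one (a : Fin n → ℕ) (b : ℕ) :
    splitDim K (Fin.cons 1 a : Fin (n + 1) → ℕ) b = splitDim K a b := by
  rw [splitDim, ← quotDim_map_elim 0, powIdeal_cons, Ideal.map_sup, Ideal.map_sup,
    map_elim_span, Ideal.map_span, Ideal.map_span, splitDim]
  · simp [Fin.sum_univ_succ]
  · refine Ideal.mem_sup_left ?_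
    have := X_pow_mem_powIdeal (K := K) (a := (Fin.cons 1 a : Fin (n + 1) → ℕ)) (i := 0)
      (m := 1) (by simp)
    simpa using this

lemma diagDim_cons_one (a : Fin n → ℕ) :
    diagDim K (Fin.cons 1 a : Fin (n + 1) → ℕ) 1 = diagDim K a 1 := by
  rw [diagDim_cons, splitDim_one]

lemma map_substPow_powIdeal (c a : Fin n → ℕ) :
    (powIdeal K a).map (substPow K c) = powIdeal K (c * a) := by
  rw [powIdeal, Ideal.map_span, ← Set.range_comp, powIdeal]
  congr 2
  ext1 i
  simp [pow_mul]

lemma powIdeal_one : powIdeal K (1 : Fin n → ℕ) = idealOfVars (Fin n) K := by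
  simp [powIdeal]

lemma sub_C_mem_powIdeal_one (x : MvPolynomial (Fin n) K) :
    x - C (constantCoeff x) ∈ powIdeal K (1 : Fin n → ℕ) := by
  rw [powIdeal_one, ← pow_one (idealOfVars (Fin n) K), mem_pow_idealOfVars_iff']
  intro m hm
  have : m = 0 := by simpa [Finsupp.degree_eq_zero_iff] using hm
  subst this
  simp [constantCoeff_eq]

lemma quotDim_powIdeal (a : Fin n → ℕ) : quotDim K (powIdeal K a) = (∏ i, a i : ℕ) := by
  by_cases ha : ∀ i, 0 < a i
  · have h1 : quotDim K (powIdeal K (1 : Fin n → ℕ)) = 1 := by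
      rw [quotDim_eq_length_of_ker_eq _ (aeval (0 : Fin n → K)).toLinearMap]
      · simp
      · intro x
        exact ⟨C x, by simp⟩
      · intro x
        have hx := sub_C_mem_powIdeal_one x
        have h₀ : (aeval (0 : Fin n → K)).toLinearMap x = constantCoeff x := by
          simp [aeval_zero]
        rw [h₀]
        refine ⟨fun h => by simpa [h] using hx, fun h => ?_⟩
        have hle : powIdeal K (1 : Fin n → ℕ) ≤ RingHom.ker (constantCoeff (σ := Fin n) (R := K)) :=
          Ideal.span_le.2 (by rintro _ ⟨i, rfl⟩; simp)
        exact hle h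
    rw [← mul_one a, ← map_substPow_powIdeal, quotDim_map_substPow a ha, h1]
    simp
  · push Not at ha
    obtain ⟨i, hi⟩ := ha
    rw [powIdeal_eq_top (Nat.le_zero.1 hi), quotDim_top, Finset.prod_eq_zero (Finset.mem_univ i)
      (Nat.le_zero.1 hi), Nat.cast_zero]

lemma splitDim_le (a : Fin n → ℕ) (b : ℕ) : splitDim K a b ≤ (∏ i, a i : ℕ) := by
  rw [← quotDim_powIdeal (K := K)]
  exact quotDim_anti le_sup_left

/-- In characteristic p, (∑ x_i)^p = ∑ x_i^p already lies in the ideal of powers. This is the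
boundary value of the wave equation at b = p. -/
lemma splitDim_eq_prod (p : ℕ) [Fact p.Prime] [CharP K p] (a : Fin n → ℕ) (ha : ∀ i, a i ≤ p) :
    splitDim K a p = (∏ i, a i : ℕ) := by
  rw [← quotDim_powIdeal (K := K), splitDim, sup_eq_left.2]
  rw [Ideal.span_singleton_le_iff_mem, sum_pow_char]
  exact Ideal.sum_mem _ fun i _ => X_pow_mem_powIdeal (ha i)

lemma splitDim_of_isEmpty (a : Fin 0 → ℕ) (b : ℕ) (hb : b ≠ 0) : splitDim K a b = 1 := by
  have := quotDim_powIdeal (K := K) a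
  rw [splitDim, sup_eq_left.2]
  · simpa using this
  · simp [hb]

/-- Substituting x_i^p for x_i turns (∑ x_i)^b into (∑ x_i)^(pb). -/
lemma splitDim_frobenius (p : ℕ) [hp : Fact p.Prime] [CharP K p] (a : Fin n → ℕ) (b : ℕ) :
    splitDim K (fun i => p * a i) (p * b) = (p ^ n : ℕ) * splitDim K a b := by
  have h := quotDim_map_substPow (K := K) (fun _ : Fin n => p) (fun _ => hp.out.pos)
    (powIdeal K a ⊔ Ideal.span {(∑ i, X i) ^ b})
  rw [Ideal.map_sup, map_substPow_powIdeal, Ideal.map_span] at h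
  simp only [Finset.prod_const, Finset.card_univ, Fintype.card_fin, Set.image_singleton, map_pow,
    map_sum, substPow_X] at h
  rw [← sum_pow_char, ← pow_mul] at h
  exact h

lemma diagDim_mul (c a : Fin n → ℕ) (hc : ∀ i, 0 < c i) :
    diagDim K (c * a) c = (∏ i, c i : ℕ) * diagDim K a 1 := by
  rw [diagDim, diagDim, ← quotDim_map_substPow c hc, Ideal.map_sup, map_substPow_powIdeal,
    Ideal.map_span]
  simp

lemma diagDim_frobenius (p : ℕ) [Fact p.Prime] [CharP K p] (a : Fin (n + 1) → ℕ) :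
    diagDim K (fun i => p * a i) 1 = (p ^ n : ℕ) * diagDim K a 1 := by
  have h : ∀ a : Fin (n + 1) → ℕ, diagDim K a 1 = splitDim K (Fin.tail a) (a 0) := fun a => by
    rw [← diagDim_cons, Fin.cons_self_tail]
  rw [h, h, ← splitDim_frobenius]
  rfl

/-- This is `quotDim_wave` for δ = ∂/∂x_0, f = x_0, g = ∑ x_i and J generated by the powers of the
other variables. -/
lemma splitDim_wave (a : Fin n → ℕ) (b c : ℕ) (hb : ((b + 1 : ℕ) : K) ≠ 0)
    (hc : ((c + 1 : ℕ) : K) ≠ 0) :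
    splitDim K (Fin.cons (c + 2) a : Fin (n + 1) → ℕ) (b + 1) +
        splitDim K (Fin.cons c a : Fin (n + 1) → ℕ) (b + 1) =
      splitDim K (Fin.cons (c + 1) a : Fin (n + 1) → ℕ) (b + 2) +
        splitDim K (Fin.cons (c + 1) a : Fin (n + 1) → ℕ) b := by
  have h := quotDim_wave (K := K) (pderiv (0 : Fin (n + 1)))
    (Ideal.span (Set.range fun i : Fin n => X i.succ ^ a i)) ?_ (X 0) (∑ i, X i) (by simp) ?_ c b
    hc hb
  · simp only [splitDim, powIdeal_cons]
    rw [sup_right_comm, sup_right_comm _ (Ideal.span {X 0 ^ c}), h]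
  · intro x hx
    refine Submodule.span_induction (p := fun x _ => pderiv (0 : Fin (n + 1)) x ∈ Ideal.span
      (Set.range fun i : Fin n => (X i.succ ^ a i : MvPolynomial (Fin (n + 1)) K)))
      ?_ ?_ ?_ ?_ hx
    · rintro _ ⟨i, rfl⟩
      simp [pderiv_X_of_ne (Fin.succ_ne_zero i)]
    · simp
    · intro x y _ _ hx hy
      simpa using Ideal.add_mem _ hx hy
    · intro r x hx' hx
      rw [smul_eq_mul, Derivation.leibniz]
      exact Ideal.add_mem _ (Ideal.mul_mem_left _ _ hx) (Ideal.mul_mem_right _ _ hx')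
  · simp [Fin.sum_univ_succ, pderiv_X_of_ne (Fin.succ_ne_zero _)]

lemma diagDim_update_succ_le (a : Fin n → ℕ) (i : Fin n) (m : ℕ) :
    diagDim K (Function.update a i (m + 1)) 1 ≤
      diagDim K (Function.update a i m) 1 + diagDim K (Function.update a i 1) 1 := by
  have h : ∀ m, powIdeal K (Function.update a i m) ⊔ Ideal.span {∑ i, X i ^ (1 : Fin n → ℕ) i} =
      (Ideal.span ((fun j => X j ^ a j) '' {i}ᶜ) ⊔ Ideal.span {∑ i, X i ^ (1 : Fin n → ℕ) i}) ⊔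
        Ideal.span {X i ^ m} := by
    intro m
    rw [sup_right_comm]
    congr 1
    rw [powIdeal, ← Ideal.span_union]
    congr 1
    ext x
    simp only [Set.mem_range, Set.mem_union, Set.mem_image, Set.mem_compl_iff,
      Set.mem_singleton_iff]
    constructor
    · rintro ⟨j, rfl⟩
      by_cases hj : j = i
      · subst hj
        simp
      · exact Or.inl ⟨j, hj, by simp [hj]⟩
    · rintro (⟨j, hj, rfl⟩ | rfl)
      · exact ⟨j, by simp [hj]⟩
      · exact ⟨i, by simp⟩
  rw [diagDim, diagDim, diagDim, h, h, h, pow_succ, pow_one]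
  exact quotDim_sup_span_mul_le _ _ _

end Diagonal

/-! ### Box sums and the staircase function. -/

section Box

/-- The sum of `h` over the `a` points of step two centred at `j`. -/
def box (a : ℕ) (h : ℤ → ℝ) (j : ℤ) : ℝ := ∑ i ∈ Finset.range a, h (j - a + 1 + 2 * i)

/-- The iterated box sum. -/
def boxIter : ∀ {n : ℕ}, (Fin n → ℕ) → (ℤ → ℝ) → ℤ → ℝ
  | 0, _, h => h
  | _ + 1, a, h => box (a 0) (boxIter (Fin.tail a) h)

lemma boxIter_cons {n : ℕ} (c : ℕ) (a : Fin n → ℕ) (h : ℤ → ℝ) :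
    boxIter (Fin.cons c a : Fin (n + 1) → ℕ) h = box c (boxIter a h) := rfl

@[simp]
lemma box_zero (h : ℤ → ℝ) (j : ℤ) : box 0 h j = 0 := by simp [box]

@[simp]
lemma box_one (h : ℤ → ℝ) : box 1 h = h := by
  ext j
  simp [box]

/-- The rightmost point j + a + 1 is moved from the box of length a + 2 to the box of length a. -/
lemma box_wave (a : ℕ) (h : ℤ → ℝ) (j : ℤ) :
    box (a + 2) h j + box a h j = box (a + 1) h (j + 1) + box (a + 1) h (j - 1) := by
  have h₁ : box (a + 2) h j = box (a + 1) h (j - 1) + h (j + a + 1) := by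
    rw [box, Finset.sum_range_succ, box]
    congr 1
    · refine Finset.sum_congr rfl fun i _ => ?_
      congr 1
      push_cast
      ring
    · congr 1
      push_cast
      ring
  have h₂ : box (a + 1) h (j + 1) = box a h j + h (j + a + 1) := by
    rw [box, Finset.sum_range_succ, box]
    congr 1
    · refine Finset.sum_congr rfl fun i _ => ?_
      congr 1
      push_cast
      ring
    · congr 1
      push_cast
      ring
  rw [h₁, h₂]
  ring

lemma box_reflect (a : ℕ) (h : ℤ → ℝ) (j : ℤ) :
    box a h j = ∑ i ∈ Finset.range a, h (j - (-a + 1 + 2 * i)) := by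
  rw [box, ← Finset.sum_range_reflect]
  refine Finset.sum_congr rfl fun i hi => ?_
  have := Finset.mem_range.1 hi
  congr 1
  have : ((a - 1 - i : ℕ) : ℤ) = a - 1 - i := by omega
  rw [this]
  ring

/-- Functions that are odd about `(0, 0)` and about `(p, h p)`. -/
structure IsReflective (p : ℤ) (h : ℤ → ℝ) : Prop where
  odd : ∀ j, h (-j) = -h j
  refl : ∀ k, h (p + k) + h (p - k) = 2 * h p

lemma IsReflective.box_apply {p : ℤ} {h : ℤ → ℝ} (hh : IsReflective p h) (a : ℕ) (k : ℤ) :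
    box a h (p + k) + box a h (p - k) = 2 * (a * h p) := by
  rw [box_reflect a h (p - k), box, ← Finset.sum_add_distrib]
  have : ∀ i ∈ Finset.range a,
      h (p + k - a + 1 + 2 * i) + h (p - k - (-a + 1 + 2 * i)) = 2 * h p := fun i _ => by
    rw [← hh.refl (k - a + 1 + 2 * i)]
    congr 2 <;> ring
  rw [Finset.sum_congr rfl this, Finset.sum_const, Finset.card_range, nsmul_eq_mul]
  ring

lemma IsReflective.box_self {p : ℤ} {h : ℤ → ℝ} (hh : IsReflective p h) (a : ℕ) :
    box a h p = a * h p := by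
  have := hh.box_apply a 0
  simp only [add_zero, sub_zero] at this
  linarith

lemma IsReflective.box {p : ℤ} {h : ℤ → ℝ} (hh : IsReflective p h) (a : ℕ) :
    IsReflective p (box a h) where
  odd j := by
    rw [box_reflect, HilbertKunz.box, ← Finset.sum_neg_distrib]
    refine Finset.sum_congr rfl fun i _ => ?_
    rw [← hh.odd]
    congr 1
    ring
  refl k := by rw [hh.box_apply, hh.box_self]

lemma IsReflective.map_zero {p : ℤ} {h : ℤ → ℝ} (hh : IsReflective p h) : h 0 = 0 := by
  have := hh.odd 0
  simp only [neg_zero] at this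
  linarith

lemma IsReflective.boxIter {p : ℤ} {h : ℤ → ℝ} (hh : IsReflective p h) {n : ℕ} (a : Fin n → ℕ) :
    IsReflective p (boxIter a h) := by
  induction n with
  | zero => exact hh
  | succ n ih => exact (ih (Fin.tail a)).box (a 0)

/-- Oddness about (p, h p) makes each box sum at p equal to its length times the central value. This
matches `splitDim_eq_prod` at b = p. -/
lemma IsReflective.boxIter_self {p : ℤ} {h : ℤ → ℝ} (hh : IsReflective p h) {n : ℕ}
    (a : Fin n → ℕ) : HilbertKunz.boxIter a h p = (∏ i, a i : ℕ) * h p := by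
  induction n with
  | zero => simp [HilbertKunz.boxIter]
  | succ n ih =>
    rw [HilbertKunz.boxIter, (hh.boxIter _).box_self, ih, Fin.prod_univ_succ]
    simp only [Fin.tail]
    push_cast
    ring

/-- The staircase `⌊j / (2 * p)⌋ + ⌈j / (2 * p)⌉`. -/
def stair (p : ℕ) (j : ℤ) : ℝ := ((j / (2 * p) - (-j) / (2 * p) : ℤ) : ℝ)

lemma stair_eq_one {p : ℕ} {j : ℤ} (hj : 0 < j) (hjp : j ≤ p) : stair p j = 1 := by
  have h₁ : j / (2 * p) = 0 := Int.ediv_eq_zero_of_lt hj.le (by omega)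
  have h₂ : (-j) / (2 * p : ℤ) = -1 := by
    rw [Int.ediv_eq_iff_of_pos (by omega)]
    constructor <;> omega
  simp [stair, h₁, h₂]

lemma isReflective_stair {p : ℕ} (hp : 0 < p) : IsReflective p (stair p) where
  odd j := by
    simp only [stair, neg_neg]
    push_cast
    ring
  refl k := by
    rw [stair_eq_one (by omega) le_rfl, stair, stair]
    have h₁ : (p + k) / (2 * p) = (-(p - k)) / (2 * p) + 1 := by
      rw [← Int.add_mul_ediv_right _ _ (by omega)]
      congr 1
      ring
    have h₂ : (p - k) / (2 * p) = (-(p + k)) / (2 * p) + 1 := by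
      rw [← Int.add_mul_ediv_right _ _ (by omega)]
      congr 1
      ring
    rw [h₁, h₂]
    push_cast
    ring

end Box

/-! ### The exact formula for exponents at most p. -/

section Formula

variable {K : Type*} [Field K] {n : ℕ}

lemma splitDim_ne_top (a : Fin n → ℕ) (b : ℕ) : splitDim K a b ≠ ⊤ :=
  ne_top_of_le_ne_top (ENat.natCast_ne_top _) (splitDim_le a b)

/-- Both sides satisfy the same wave equation in the first exponent c and in b. They agree for c =
0, for c = 1 (one variable fewer), for b = 0 and for b = p, so they agree throughout. -/
theorem splitDim_eq_boxIter (p : ℕ) [hp : Fact p.Prime] [CharP K p] (a : Fin n → ℕ)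
    (ha : ∀ i, a i ≤ p) (b : ℕ) (hb : b ≤ p) :
    ((splitDim K a b).toNat : ℝ) = boxIter a (stair p) b := by
  have hstair := isReflective_stair hp.out.pos
  have hself : stair p p = 1 := stair_eq_one (by have := hp.out.pos; omega) le_rfl
  have hcast : ∀ m : ℕ, m + 1 < p → ((m + 1 : ℕ) : K) ≠ 0 := fun m hm h => by
    rw [CharP.cast_eq_zero_iff K p] at h
    exact absurd (Nat.le_of_dvd (Nat.succ_pos m) h) (by omega)
  induction n generalizing b with
  | zero =>
    rcases Nat.eq_zero_or_pos b with rfl | hb0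
    · rw [splitDim_zero]
      simpa using (hstair.boxIter a).map_zero.symm
    · rw [splitDim_of_isEmpty a b hb0.ne']
      simpa [boxIter] using (stair_eq_one (p := p) (by omega) (by omega)).symm
  | succ n ih =>
    induction a using Fin.consCases with
    | _ c a =>
    have ha' : ∀ i, a i ≤ p := fun i => by simpa using ha i.succ
    have hc : c ≤ p := by simpa using ha 0
    clear ha
    rw [boxIter_cons]
    induction c using Nat.twoStepInduction generalizing b with
    | zero =>
      rw [splitDim_eq_zero (i := 0) (by simp)]
      simp
    | one => rw [splitDim_cons_one, ih a ha' b hb, box_one]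
    | more c ih₀ ih₁ =>
      rcases Nat.eq_zero_or_pos b with rfl | hb0
      · rw [splitDim_zero]
        simpa using ((hstair.boxIter a).box _).map_zero.symm
      rcases hb.eq_or_lt with rfl | hbp
      · rw [splitDim_eq_prod b _ (Fin.cases (by simpa using hc) (by simpa using ha')),
          (hstair.boxIter a).box_self, hstair.boxIter_self, hself, Fin.prod_univ_succ,
          ENat.toNat_natCast]
        simp
      -- In the interior 0 < b < p the wave equation is available, because its two coefficients are
      -- smaller than p and hence invertible in K.
      obtain ⟨b, rfl⟩ := Nat.exists_eq_add_of_lt hb0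
      simp only [zero_add] at *
      have hw := congrArg (fun x : ℕ∞ => (x.toNat : ℝ))
        (splitDim_wave (K := K) a b c (hcast b hbp) (hcast c (by omega)))
      simp only [ENat.toNat_add (splitDim_ne_top _ _) (splitDim_ne_top _ _), Nat.cast_add] at hw
      rw [ih₀ (b + 1) hb (by omega), ih₁ (b + 2) (by omega) (by omega),
        ih₁ b (by omega) (by omega)] at hw
      have hw' := box_wave c (boxIter a (stair p)) (b + 1)
      push_cast at hw hw' ⊢
      rw [show (b : ℤ) + 1 + 1 = b + 2 by ring, add_sub_cancel_right] at hw'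
      linarith

end Formula

/-! ### Growth of the dimensions and comparison of the diagonal with the linear case. -/

section Growth

variable {K : Type*} [Field K] {n : ℕ}

lemma diagDim_eq_splitDim (a : Fin (n + 1) → ℕ) :
    diagDim K a 1 = splitDim K (Fin.tail a) (a 0) := by
  rw [← diagDim_cons, Fin.cons_self_tail]

lemma diagDim_one_ne_top (a : Fin (n + 1) → ℕ) : diagDim K a 1 ≠ ⊤ := by
  rw [diagDim_eq_splitDim]
  exact splitDim_ne_top _ _

lemma diagDim_le_pow {a : Fin (n + 1) → ℕ} {M : ℕ} (ha : ∀ i, a i ≤ M) :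
    diagDim K a 1 ≤ (M ^ n : ℕ) := by
  rw [diagDim_eq_splitDim]
  refine (splitDim_le _ _).trans (Nat.cast_le.2 ?_)
  simpa using Finset.prod_le_pow_card Finset.univ (Fin.tail a) M fun i _ => ha i.succ

/-- Exponent one kills a variable and the linear relation eliminates another, which leaves n
exponents. This bounds the cost of raising one exponent by one. -/
lemma diagDim_update_one_le {a : Fin (n + 2) → ℕ} {M : ℕ} (ha : ∀ i, a i ≤ M) (i : Fin (n + 2)) :
    diagDim K (Function.update a i 1) 1 ≤ (M ^ n : ℕ) := by
  induction i using Fin.cases with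
  | zero =>
    rw [← Fin.cons_self_tail a, Fin.update_cons_zero, diagDim_cons_one]
    exact diagDim_le_pow fun i => ha i.succ
  | succ i =>
    rw [← Fin.cons_self_tail a, ← Fin.cons_update, diagDim_cons]
    refine (splitDim_le _ _).trans (Nat.cast_le.2 ?_)
    rw [Finset.prod_update_of_mem (Finset.mem_univ i), one_mul]
    refine (Finset.prod_le_pow_card _ _ M fun j _ => ha j.succ).trans_eq ?_
    rw [Finset.card_sdiff_of_subset (Finset.subset_univ _)]
    simp

lemma diagDim_le_add {a a' : Fin (n + 2) → ℕ} {M : ℕ} (h : a ≤ a') (ha' : ∀ i, a' i ≤ M) :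
    diagDim K a' 1 ≤ diagDim K a 1 + ((∑ i, (a' i - a i)) * M ^ n : ℕ) := by
  induction hN : ∑ i, (a' i - a i) generalizing a' with
  | zero =>
    have : a' = a := by
      ext i
      have h₁ : a' i - a i = 0 := Finset.sum_eq_zero_iff.1 hN i (Finset.mem_univ i)
      have h₂ : a i ≤ a' i := h i
      omega
    simp [this]
  | succ N ih =>
    obtain ⟨i, -, hi⟩ : ∃ i ∈ Finset.univ, a' i - a i ≠ 0 := by
      by_contra! hcon
      rw [Finset.sum_eq_zero hcon] at hN
      omega
    obtain ⟨m, hm⟩ : ∃ m, a' i = m + 1 := Nat.exists_eq_succ_of_ne_zero (by omega)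
    have hself : a' = Function.update a' i (m + 1) := by rw [← hm, Function.update_eq_self]
    have h₁ : a ≤ Function.update a' i m := by
      intro j
      by_cases hj : j = i
      · subst hj
        simp
        omega
      · simpa [hj] using h j
    have h₂ : ∀ j, Function.update a' i m j ≤ M := by
      intro j
      by_cases hj : j = i
      · subst hj
        have := ha' j
        simp
        omega
      · simpa [hj] using ha' j
    have h₃ : ∑ j, (Function.update a' i m j - a j) = N := by
      rw [← Finset.add_sum_erase _ _ (Finset.mem_univ i)] at hN ⊢
      have : ∑ j ∈ Finset.univ.erase i, (Function.update a' i m j - a j) =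
          ∑ j ∈ Finset.univ.erase i, (a' j - a j) :=
        Finset.sum_congr rfl fun j hj => by simp [Finset.ne_of_mem_erase hj]
      rw [this]
      simp
      omega
    calc diagDim K a' 1 = diagDim K (Function.update a' i (m + 1)) 1 := by rw [← hself]
      _ ≤ diagDim K (Function.update a' i m) 1 + diagDim K (Function.update a' i 1) 1 :=
        diagDim_update_succ_le a' i m
      _ ≤ (diagDim K a 1 + (N * M ^ n : ℕ)) + (M ^ n : ℕ) :=
        add_le_add (ih h₁ h₂ h₃) (diagDim_update_one_le ha' i)
      _ = _ := by
        rw [add_assoc]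
        push_cast
        ring

/-- With `diagDim_const_le` this encloses the diagonal dimension between linear ones whose exponents
are the roundings of q/d_i. -/
lemma le_diagDim_const {d a : Fin n → ℕ} (hd : ∀ i, 0 < d i) {q : ℕ} (h : ∀ i, d i * a i ≤ q) :
    (∏ i, d i : ℕ) * diagDim K a 1 ≤ diagDim K (fun _ => q) d := by
  rw [← diagDim_mul d a hd]
  exact diagDim_mono h d

lemma diagDim_const_le {d a : Fin n → ℕ} (hd : ∀ i, 0 < d i) {q : ℕ} (h : ∀ i, q ≤ d i * a i) :
    diagDim K (fun _ => q) d ≤ (∏ i, d i : ℕ) * diagDim K a 1 := by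
  rw [← diagDim_mul d a hd]
  exact diagDim_mono h d

/-- The dimension of `K[x] / (x_i ^ a_i, ∑ x_i)` as a natural number. -/
def linNat (K : Type*) [Field K] (a : Fin n → ℕ) : ℕ := (diagDim K a 1).toNat

lemma coe_linNat (a : Fin (n + 1) → ℕ) : (linNat K a : ℕ∞) = diagDim K a 1 :=
  ENat.natCast_toNat (diagDim_one_ne_top a)

lemma diagDim_const_ne_top {d : Fin (n + 1) → ℕ} (hd : ∀ i, 0 < d i) (q : ℕ) :
    diagDim K (fun _ => q) d ≠ ⊤ := by
  have h := diagDim_const_le (K := K) hd fun i => Nat.le_mul_of_pos_left q (hd i)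
  rw [← coe_linNat, ← Nat.cast_mul] at h
  exact ne_top_of_le_ne_top (ENat.natCast_ne_top _) h

/-- The dimension of `K[x] / (x_i ^ q, ∑ x_i ^ d_i)` as a natural number. -/
def diagNat (K : Type*) [Field K] (d : Fin n → ℕ) (q : ℕ) : ℕ := (diagDim K (fun _ => q) d).toNat

lemma coe_diagNat {d : Fin (n + 1) → ℕ} (hd : ∀ i, 0 < d i) (q : ℕ) :
    (diagNat K d q : ℕ∞) = diagDim K (fun _ => q) d :=
  ENat.natCast_toNat (diagDim_const_ne_top hd q)

lemma linNat_le_diagNat {d a : Fin (n + 1) → ℕ} (hd : ∀ i, 0 < d i) {q : ℕ}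
    (h : ∀ i, d i * a i ≤ q) : (∏ i, d i) * linNat K a ≤ diagNat K d q := by
  have := le_diagDim_const (K := K) hd h
  rw [← coe_diagNat hd, ← coe_linNat] at this
  exact_mod_cast this

lemma diagNat_le_linNat {d a : Fin (n + 1) → ℕ} (hd : ∀ i, 0 < d i) {q : ℕ}
    (h : ∀ i, q ≤ d i * a i) : diagNat K d q ≤ (∏ i, d i) * linNat K a := by
  have := diagDim_const_le (K := K) hd h
  rw [← coe_diagNat hd, ← coe_linNat] at this
  exact_mod_cast this

lemma linNat_frobenius (p : ℕ) [Fact p.Prime] [CharP K p] (a : Fin (n + 1) → ℕ) :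
    linNat K (fun i => p * a i) = p ^ n * linNat K a := by
  have := diagDim_frobenius (K := K) p a
  rw [← coe_linNat, ← coe_linNat] at this
  exact_mod_cast this

lemma linNat_le_add {a a' : Fin (n + 2) → ℕ} {M : ℕ} (h : a ≤ a') (ha' : ∀ i, a' i ≤ M) :
    linNat K a' ≤ linNat K a + (∑ i, (a' i - a i)) * M ^ n := by
  have := diagDim_le_add (K := K) h ha'
  rw [← coe_linNat, ← coe_linNat] at this
  exact_mod_cast this

lemma linNat_fin_one {a : Fin 1 → ℕ} (ha : 0 < a 0) : linNat K a = 1 := by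
  rw [linNat, diagDim_eq_splitDim, splitDim_of_isEmpty _ _ ha.ne']
  rfl

/-- The Hilbert–Kunz function of a diagonal hypersurface is almost multiplicative in `p`. -/
lemma abs_diagNat_sub_le (p : ℕ) [hp : Fact p.Prime] [CharP K p] {d : Fin (n + 2) → ℕ}
    (hd : ∀ i, 0 < d i) {q : ℕ} (hq : 1 ≤ q) :
    |(diagNat K d (p * q) : ℝ) - p ^ (n + 1) * diagNat K d q| ≤
      (∏ i, d i : ℕ) * ((n + 2) * p * (2 * p * q) ^ n) := by
  -- Both quantities to be compared lie between P times the linear dimensions with exponents p·a_i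
  -- and p·(a_i + 1), and these two are close by `linNat_le_add`.
  set a : Fin (n + 2) → ℕ := fun i => q / d i
  set P := ∏ i, d i
  have hlo : ∀ i, d i * a i ≤ q := fun i => Nat.mul_div_le q (d i)
  have hhi : ∀ i, q ≤ d i * (a i + 1) := fun i => (Nat.lt_mul_div_succ q (hd i)).le
  have h₁ : P * linNat K (fun i => p * a i) ≤ p ^ (n + 1) * diagNat K d q := by
    rw [linNat_frobenius, mul_left_comm]
    exact Nat.mul_le_mul_left _ (linNat_le_diagNat hd hlo)
  have h₂ : p ^ (n + 1) * diagNat K d q ≤ P * linNat K (fun i => p * (a i + 1)) := by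
    rw [linNat_frobenius p fun i => a i + 1, mul_left_comm]
    exact Nat.mul_le_mul_left _ (diagNat_le_linNat hd hhi)
  have h₃ : P * linNat K (fun i => p * a i) ≤ diagNat K d (p * q) :=
    linNat_le_diagNat hd fun i => by
      rw [mul_left_comm]
      exact Nat.mul_le_mul_left _ (hlo i)
  have h₄ : diagNat K d (p * q) ≤ P * linNat K (fun i => p * (a i + 1)) :=
    diagNat_le_linNat hd fun i => by
      rw [mul_left_comm]
      exact Nat.mul_le_mul_left _ (hhi i)
  have h₅ : linNat K (fun i => p * (a i + 1)) ≤
      linNat K (fun i => p * a i) + (n + 2) * p * (2 * p * q) ^ n := by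
    refine (linNat_le_add (M := 2 * p * q) (a := fun i => p * a i)
      (fun i => Nat.mul_le_mul_left _ (Nat.le_succ _)) fun i => ?_).trans_eq ?_
    · have : a i ≤ q := Nat.div_le_self _ _
      rw [mul_comm 2 p, mul_assoc]
      exact Nat.mul_le_mul_left _ (by omega)
    · simp [mul_add]
  have h₆ := Nat.mul_le_mul_left P h₅
  rw [mul_add] at h₆
  rify at h₁ h₂ h₃ h₄ h₆
  rw [abs_le]
  constructor <;> linarith

end Growth

/-! ### Alternating sums over signs. -/

section SignSum

variable {G : Type*} [AddCommGroup G] {n : ℕ}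

/-- The alternating sum of `f` over the points `x + ε₁ a₁ + ⋯ + εₙ aₙ`. -/
def signSum (a : Fin n → G) (f : G → ℝ) (x : G) : ℝ :=
  ∑ ε : Fin n → ℤˣ, (∏ i, ((ε i : ℤ) : ℝ)) * f (x + ∑ i, (ε i : ℤ) • a i)

lemma signSum_fin_zero (a : Fin 0 → G) (f : G → ℝ) (x : G) : signSum a f x = f x := by
  simp [signSum]

lemma signSum_succ (a : Fin (n + 1) → G) (f : G → ℝ) (x : G) :
    signSum a f x = signSum (Fin.tail a) f (x + a 0) - signSum (Fin.tail a) f (x - a 0) := by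
  rw [signSum, ← (Fin.consEquiv fun _ => ℤˣ).sum_comp, Fintype.sum_prod_type]
  have : (Finset.univ : Finset ℤˣ) = {1, -1} := rfl
  rw [this, Finset.sum_pair (by decide), sub_eq_add_neg, signSum, signSum,
    ← Finset.sum_neg_distrib]
  congr 1 <;>
  · refine Finset.sum_congr rfl fun ε _ => ?_
    simp [Fin.consEquiv, Fin.prod_univ_succ, Fin.sum_univ_succ, Fin.tail, add_assoc,
      sub_eq_add_neg]

lemma signSum_sub (a : Fin n → G) (f g : G → ℝ) (x : G) :
    signSum a (fun y => f y - g y) x = signSum a f x - signSum a g x := by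
  simp [signSum, mul_sub, Finset.sum_sub_distrib]

lemma signSum_comp_add (a : Fin n → G) (f : G → ℝ) (x c : G) :
    signSum a (fun y => f (y + c)) x = signSum a f (x + c) := by
  simp [signSum, add_right_comm]

lemma abs_units_prod (ε : Fin n → ℤˣ) : |∏ i, ((ε i : ℤ) : ℝ)| = 1 := by
  rw [Finset.abs_prod]
  refine Finset.prod_eq_one fun i _ => ?_
  rcases Int.units_eq_one_or (ε i) with h | h <;> simp [h]

lemma abs_signSum_le (a : Fin n → G) (f : G → ℝ) (x : G) {B : ℝ}
    (h : ∀ ε : Fin n → ℤˣ, |f (x + ∑ i, (ε i : ℤ) • a i)| ≤ B) :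
    |signSum a f x| ≤ 2 ^ n * B := by
  refine (Finset.abs_sum_le_sum_abs _ _).trans ?_
  refine (Finset.sum_le_card_nsmul _ _ B fun ε _ => ?_).trans_eq ?_
  · rw [abs_mul, abs_units_prod, one_mul]
    exact h ε
  · simp

/-- The alternating sum is an n-fold symmetric difference, and each difference lowers the degree. -/
lemma signSum_eval_eq_zero (a : Fin n → ℝ) (P : Polynomial ℝ) (hP : P.degree < n) (x : ℝ) :
    signSum a (fun y => P.eval y) x = 0 := by
  induction n generalizing P with
  | zero =>
    have : P = 0 := by
      rw [← Polynomial.degree_eq_bot]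
      simpa [Nat.WithBot.lt_zero_iff] using hP
    simp [signSum, this]
  | succ n ih =>
    by_cases h0 : P = 0
    · simp [signSum, h0]
    have := ih (Fin.tail a) (Polynomial.taylor (a 0) P - Polynomial.taylor (-a 0) P) ?_
    · simp only [Polynomial.eval_sub, Polynomial.taylor_eval] at this
      rw [signSum_sub, signSum_comp_add _ (fun y => P.eval y),
        signSum_comp_add _ (fun y => P.eval y)] at this
      rw [signSum_succ, sub_eq_add_neg x]
      exact this
    · have hlt : (Polynomial.taylor (a 0) P - Polynomial.taylor (-a 0) P).degree <
          (Polynomial.taylor (a 0) P).degree := by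
        refine Polynomial.degree_sub_lt_left ?_ ?_ ?_
        · simp
        · simpa using h0
        · simp
      rw [Polynomial.degree_taylor] at hlt
      refine lt_of_lt_of_le hlt ?_
      exact Polynomial.degree_le_of_natDegree_le (Nat.lt_succ_iff.1
        ((Polynomial.natDegree_lt_iff_degree_lt h0).2 hP))

end SignSum

/-! ### Estimates for truncated powers. -/

section TruncatedPower

/-- The truncated power `2 (y₊ / 2) ^ k / k!`. -/
def truncPow (k : ℕ) (y : ℝ) : ℝ := if 0 ≤ y then 2 * (y / 2) ^ k / k.factorial else 0

lemma one_le_factorial_cast (k : ℕ) : (1 : ℝ) ≤ k.factorial := by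
  exact_mod_cast k.factorial_pos

lemma truncPow_succ (k : ℕ) (y : ℝ) :
    truncPow (k + 1) y = 2 * (max y 0 / 2) ^ (k + 1) / (k + 1).factorial := by
  rw [truncPow]
  split_ifs with h
  · rw [max_eq_left h]
  · rw [max_eq_right (not_le.1 h).le]
    simp

lemma truncPow_mul (k : ℕ) {c : ℝ} (hc : 0 < c) (y : ℝ) :
    truncPow k (c * y) = c ^ k * truncPow k y := by
  simp only [truncPow, mul_nonneg_iff_of_pos_left hc]
  split_ifs
  · rw [mul_div_assoc c, mul_pow]
    ring
  · simp

lemma abs_truncPow_succ_sub_le (k : ℕ) {y z B : ℝ} (hy : |y| ≤ B) (hz : |z| ≤ B) :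
    |truncPow (k + 1) y - truncPow (k + 1) z| ≤ 2 * (k + 1) * |y - z| * B ^ k := by
  have hB : 0 ≤ B := (abs_nonneg y).trans hy
  have hpow : ∀ u v : ℝ, |u| ≤ B → |v| ≤ B →
      |u ^ (k + 1) - v ^ (k + 1)| ≤ (k + 1) * |u - v| * B ^ k := by
    intro u v hu hv
    refine (abs_pow_sub_pow_le _ _ _).trans ?_
    rw [Nat.add_sub_cancel, mul_comm |u - v|, Nat.cast_add_one]
    gcongr
    exact max_le hu hv
  have hmax : ∀ u : ℝ, |u| ≤ B → |max u 0 / 2| ≤ B := fun u hu => by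
    rw [abs_of_nonneg (by positivity)]
    have : max u 0 ≤ B := max_le ((le_abs_self u).trans hu) hB
    linarith
  have hlip : |max y 0 / 2 - max z 0 / 2| ≤ |y - z| := by
    rw [← sub_div, abs_div, abs_of_pos (two_pos : (0 : ℝ) < 2)]
    have := abs_max_sub_max_le_abs y z 0
    have := abs_nonneg (max y 0 - max z 0)
    linarith
  rw [truncPow_succ, truncPow_succ, ← sub_div, ← mul_sub, abs_div, abs_mul, Nat.abs_cast,
    abs_of_pos (two_pos : (0 : ℝ) < 2)]
  refine (div_le_self (by positivity) (one_le_factorial_cast _)).trans ?_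
  have := hpow _ _ (hmax y hy) (hmax z hz)
  calc 2 * |(max y 0 / 2) ^ (k + 1) - (max z 0 / 2) ^ (k + 1)|
      ≤ 2 * ((k + 1) * |max y 0 / 2 - max z 0 / 2| * B ^ k) := by gcongr
    _ ≤ 2 * ((k + 1) * |y - z| * B ^ k) := by gcongr
    _ = _ := by ring

lemma exists_abs_add_pow_sub_le (m : ℕ) : ∃ C : ℝ, 0 ≤ C ∧ ∀ z t : ℝ, 1 ≤ z → |t| ≤ 1 →
    |(z + t) ^ (m + 2) - z ^ (m + 2) - (m + 2) * t * z ^ (m + 1)| ≤ C * z ^ m := by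
  induction m with
  | zero =>
    refine ⟨1, zero_le_one, fun z t _ ht => ?_⟩
    have : (z + t) ^ 2 - z ^ 2 - ((0 : ℕ) + 2) * t * z ^ 1 = t ^ 2 := by
      push_cast
      ring
    rw [zero_add, zero_add, this, abs_pow]
    simpa using ht
  | succ m ih =>
    obtain ⟨C, hC, h⟩ := ih
    refine ⟨2 * C + (m + 2), by positivity, fun z t hz ht => ?_⟩
    have e : (z + t) ^ (m + 1 + 2) - z ^ (m + 1 + 2) - ((m + 1 : ℕ) + 2) * t * z ^ (m + 1 + 1) =
        (z + t) * ((z + t) ^ (m + 2) - z ^ (m + 2) - (m + 2) * t * z ^ (m + 1)) +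
          (m + 2) * t ^ 2 * z ^ (m + 1) := by
      push_cast
      ring
    rw [e]
    have h₁ : |z + t| ≤ 2 * z := by
      rw [abs_le] at ht ⊢
      constructor <;> linarith
    have h₂ : |t ^ 2| ≤ 1 := by
      rw [abs_pow]
      exact pow_le_one₀ (abs_nonneg t) ht
    refine (abs_add_le _ _).trans ?_
    have hz0 : 0 ≤ z := by linarith
    calc |(z + t) * ((z + t) ^ (m + 2) - z ^ (m + 2) - (m + 2) * t * z ^ (m + 1))| +
          |(m + 2) * t ^ 2 * z ^ (m + 1)|
        = |z + t| * |(z + t) ^ (m + 2) - z ^ (m + 2) - (m + 2) * t * z ^ (m + 1)| +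
          (m + 2) * |t ^ 2| * z ^ (m + 1) := by
          rw [abs_mul, abs_mul, abs_mul, abs_of_nonneg (by positivity : (0 : ℝ) ≤ m + 2),
            abs_of_nonneg (by positivity : 0 ≤ z ^ (m + 1))]
      _ ≤ 2 * z * (C * z ^ m) + (m + 2) * 1 * z ^ (m + 1) := by
          gcongr
          exact h z t hz ht
      _ = _ := by ring

/-- The normalization of `truncPow` makes its derivative half of the preceding truncated power, so a
difference of step two reproduces that power up to a Taylor remainder. -/
lemma exists_abs_truncPow_sub_le (k : ℕ) : ∃ C : ℝ, 0 ≤ C ∧ ∀ z : ℤ,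
    |truncPow (k + 2) (z + 1 : ℤ) - truncPow (k + 2) (z - 1 : ℤ) - truncPow (k + 1) z| ≤
      C * (|(z : ℝ)| + 1) ^ k := by
  obtain ⟨C, hC, h⟩ := exists_abs_add_pow_sub_le k
  refine ⟨2 * C + 2, by positivity, fun z => ?_⟩
  rcases lt_trichotomy z 0 with hz | rfl | hz
  · have h₁ : ((z + 1 : ℤ) : ℝ) ≤ 0 := by exact_mod_cast hz
    have h₂ : ((z - 1 : ℤ) : ℝ) ≤ 0 := by exact_mod_cast (by omega : z - 1 ≤ 0)
    have h₃ : (z : ℝ) ≤ 0 := by exact_mod_cast hz.le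
    rw [truncPow_succ, truncPow_succ, truncPow_succ, max_eq_right h₁, max_eq_right h₂,
      max_eq_right h₃]
    simp
    positivity
  · have e : |truncPow (k + 2) ((0 + 1 : ℤ) : ℝ) - truncPow (k + 2) ((0 - 1 : ℤ) : ℝ) -
        truncPow (k + 1) ((0 : ℤ) : ℝ)| ≤ 2 * 1 := by
      rw [truncPow_succ, truncPow_succ, truncPow_succ]
      simp
      rw [abs_of_nonneg (by positivity)]
      refine (div_le_self (by positivity) (one_le_factorial_cast _)).trans ?_
      have : ((2 : ℝ) ^ (k + 1 + 1))⁻¹ ≤ 1 := inv_le_one_of_one_le₀ (one_le_pow₀ (by norm_num))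
      linarith
    refine e.trans ?_
    simp
    linarith
  · have hz1 : (1 : ℝ) ≤ z := by exact_mod_cast hz
    have h₁ : ((z + 1 : ℤ) : ℝ) = z + 1 := by push_cast; rfl
    have h₂ : ((z - 1 : ℤ) : ℝ) = z + -1 := by push_cast; ring
    rw [truncPow, truncPow, truncPow, if_pos (by rw [h₁]; linarith),
      if_pos (by rw [h₂]; linarith), if_pos (by linarith), h₁, h₂]
    have e : 2 * ((z + 1 : ℝ) / 2) ^ (k + 2) / (k + 2).factorial -
        2 * ((z + -1 : ℝ) / 2) ^ (k + 2) / (k + 2).factorial -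
        2 * ((z : ℝ) / 2) ^ (k + 1) / (k + 1).factorial =
        (((z + 1 : ℝ) ^ (k + 2) - z ^ (k + 2) - (k + 2) * 1 * z ^ (k + 1)) -
        ((z + -1 : ℝ) ^ (k + 2) - z ^ (k + 2) - (k + 2) * (-1) * z ^ (k + 1))) /
          (2 ^ (k + 1) * (k + 2).factorial) := by
      rw [Nat.factorial_succ (k + 1)]
      have : ((k + 1).factorial : ℝ) ≠ 0 := by exact_mod_cast Nat.factorial_ne_zero _
      have : (k : ℝ) + 2 ≠ 0 := by positivity
      push_cast
      rw [show (k : ℝ) + 1 + 1 = k + 2 by ring]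
      simp only [div_pow]
      field_simp
      ring
    rw [e, abs_div, abs_of_nonneg (by positivity : (0 : ℝ) ≤ 2 ^ (k + 1) * (k + 2).factorial)]
    refine (div_le_self (abs_nonneg _) (one_le_mul_of_one_le_of_one_le
      (one_le_pow₀ (by norm_num)) (one_le_factorial_cast _))).trans ?_
    refine (abs_sub _ _).trans ((add_le_add (h z 1 hz1 (by simp)) (h z (-1) hz1 (by simp))).trans ?_)
    rw [abs_of_nonneg (by linarith : (0 : ℝ) ≤ z)]
    have : (z : ℝ) ^ k ≤ (z + 1) ^ k := by gcongr; linarith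
    have h0 : (0 : ℝ) ≤ (z + 1) ^ k := by positivity
    nlinarith

end TruncatedPower

/-! ### Box sums of a unit step compared with truncated powers. -/

section BoxApprox

variable {n : ℕ}

/-- The step function with values `0`, `1`, `2` at negative, zero and positive integers. -/
def unitStep (j : ℤ) : ℝ := (if 0 < j then 1 else 0) + (if 0 ≤ j then 1 else 0)

lemma truncPow_one_sub (z : ℤ) :
    truncPow 1 (z + 1 : ℤ) - truncPow 1 (z - 1 : ℤ) = unitStep z := by
  rw [truncPow_succ, truncPow_succ, unitStep]
  rcases lt_trichotomy z 0 with hz | rfl | hz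
  · have h₁ : ((z + 1 : ℤ) : ℝ) ≤ 0 := by exact_mod_cast hz
    have h₂ : ((z - 1 : ℤ) : ℝ) ≤ 0 := by exact_mod_cast (by omega : z - 1 ≤ 0)
    rw [max_eq_right h₁, max_eq_right h₂, if_neg hz.not_gt, if_neg hz.not_ge]
    simp
  · simp
  · have h₁ : 0 ≤ ((z + 1 : ℤ) : ℝ) := by exact_mod_cast (by omega : 0 ≤ z + 1)
    have h₂ : 0 ≤ ((z - 1 : ℤ) : ℝ) := by exact_mod_cast (by omega : 0 ≤ z - 1)
    rw [max_eq_left h₁, max_eq_left h₂, if_pos hz, if_pos hz.le]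
    push_cast
    simp
    ring

lemma sub_eq_sum_of_step (f : ℤ → ℝ) (a : ℕ) (j : ℤ) :
    f (j + a) - f (j - a) = box a (fun z => f (z + 1) - f (z - 1)) j := by
  have := Finset.sum_range_sub (fun i : ℕ => f (j - a + 2 * i)) a
  rw [box]
  convert this.symm using 1
  · rw [Nat.cast_zero, mul_zero, add_zero, show j - a + 2 * a = j + a by ring]
  · refine Finset.sum_congr rfl fun i _ => ?_
    congr 2 <;> push_cast <;> ring

lemma abs_sum_units_smul_le (ε : Fin n → ℤˣ) (a : Fin n → ℤ) {M : ℝ} (ha : ∀ i, |(a i : ℝ)| ≤ M) :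
    |((∑ i, (ε i : ℤ) • a i : ℤ) : ℝ)| ≤ n * M := by
  push_cast
  refine (Finset.abs_sum_le_sum_abs _ _).trans ?_
  refine (Finset.sum_le_card_nsmul _ _ M fun i _ => ?_).trans_eq (by simp)
  rcases Int.units_eq_one_or (ε i) with h | h <;> simpa [h] using ha i

/-- Splitting off one sign gives a difference over distance 2·a_0, which telescopes into a box sum
of differences of step two. Each of these lowers the truncated power by one, with an error that is
summed over at most M points. The base case is exact by `truncPow_one_sub`. -/
theorem exists_abs_boxIter_sub_signSum_le (n R : ℕ) :
    ∃ C : ℝ, 0 ≤ C ∧ ∀ (M : ℕ) (a : Fin (n + 1) → ℕ) (j : ℤ), 1 ≤ M → (∀ i, a i ≤ M) →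
      |(j : ℝ)| ≤ R * M →
      |boxIter a unitStep j - signSum (fun i => (a i : ℤ)) (fun y => truncPow (n + 1) y) j| ≤
        C * M ^ n := by
  induction n generalizing R with
  | zero =>
    refine ⟨0, le_rfl, fun M a j _ _ _ => ?_⟩
    rw [signSum_succ, signSum_fin_zero, signSum_fin_zero,
      sub_eq_sum_of_step (fun y : ℤ => truncPow (0 + 1) y), boxIter]
    simp only [zero_add, truncPow_one_sub]
    simp [boxIter]
  | succ n ih =>
    obtain ⟨C₁, hC₁, h₁⟩ := ih (R + 1)
    obtain ⟨C₂, hC₂, h₂⟩ := exists_abs_truncPow_sub_le n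
    -- A box moves the point by at most M, hence R + 1 in the induction. There are 2^(n+1) sign
    -- vectors, and |z| + 1 at the shifted points is at most (R+1)M + (n+1)M + M.
    refine ⟨C₁ + 2 ^ (n + 1) * (C₂ * (R + n + 3) ^ n), by positivity, fun M a j hM ha hj => ?_⟩
    have hM' : (1 : ℝ) ≤ M := by exact_mod_cast hM
    set T := Fin.tail a
    set T' : Fin (n + 1) → ℤ := fun i => (T i : ℤ)
    have hT : ∀ i, T i ≤ M := fun i => ha i.succ
    rw [signSum_succ, sub_eq_sum_of_step]
    change |box (a 0) (boxIter T unitStep) j - box (a 0) (fun z =>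
      signSum T' (fun y => truncPow (n + 1 + 1) y) (z + 1) -
        signSum T' (fun y => truncPow (n + 1 + 1) y) (z - 1)) j| ≤ _
    rw [box, box, ← Finset.sum_sub_distrib]
    refine (Finset.abs_sum_le_sum_abs _ _).trans ((Finset.sum_le_card_nsmul _ _
      ((C₁ + 2 ^ (n + 1) * (C₂ * (R + n + 3) ^ n)) * M ^ n) fun i hi => ?_).trans ?_)
    · set z : ℤ := j - (a 0 : ℕ) + 1 + 2 * i
      have hz : |(z : ℝ)| ≤ (R + 1 : ℕ) * M := by
        have hi' : i + 1 ≤ a 0 := Finset.mem_range.1 hi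
        have h0 : (a 0 : ℝ) ≤ M := by exact_mod_cast ha 0
        have hi'' : (i : ℝ) + 1 ≤ a 0 := by exact_mod_cast hi'
        have : (z : ℝ) = j - a 0 + 1 + 2 * i := by simp [z]
        rw [this]
        rw [abs_le] at hj ⊢
        push_cast
        have hi0 : (0 : ℝ) ≤ i := Nat.cast_nonneg i
        constructor <;> nlinarith
      have e : signSum T' (fun y => truncPow (n + 1 + 1) y) (z + 1) -
          signSum T' (fun y => truncPow (n + 1 + 1) y) (z - 1) =
          signSum T' (fun y => truncPow (n + 1) y) z +
          signSum T' (fun y => truncPow (n + 2) (y + 1 : ℤ) - truncPow (n + 2) (y - 1 : ℤ) -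
            truncPow (n + 1) y) z := by
        rw [signSum_sub, signSum_sub, signSum_comp_add T' (fun y : ℤ => truncPow (n + 2) y) z 1,
          sub_eq_add_neg z,
          ← signSum_comp_add T' (fun y : ℤ => truncPow (n + 2) y) z (-1)]
        simp only [← sub_eq_add_neg]
        ring
      rw [e, ← sub_sub]
      refine (abs_sub _ _).trans ?_
      rw [add_mul]
      refine add_le_add (h₁ M T z hM hT hz) ?_
      rw [mul_assoc]
      refine abs_signSum_le T' _ z fun ε => (h₂ _).trans ?_
      rw [mul_assoc, ← mul_pow]
      have hsum := abs_sum_units_smul_le ε T' (M := M) fun i => by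
        simpa [T'] using hT i
      have : |((z + ∑ i, (ε i : ℤ) • T' i : ℤ) : ℝ)| + 1 ≤ (R + n + 3) * M := by
        rw [Int.cast_add]
        have := abs_add_le (z : ℝ) ((∑ i, (ε i : ℤ) • T' i : ℤ) : ℝ)
        push_cast at *
        nlinarith
      gcongr
    · rw [Finset.card_range, nsmul_eq_mul, pow_succ]
      have h0 : (a 0 : ℝ) ≤ M := by exact_mod_cast ha 0
      calc (a 0 : ℝ) * ((C₁ + 2 ^ (n + 1) * (C₂ * (R + n + 3) ^ n)) * M ^ n)
          ≤ M * ((C₁ + 2 ^ (n + 1) * (C₂ * (R + n + 3) ^ n)) * M ^ n) := by gcongr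
        _ = _ := by ring

lemma boxIter_congr {h h' : ℤ → ℝ} {N : ℤ} {a : Fin n → ℕ} {M : ℕ} (ha : ∀ i, a i ≤ M)
    (H : ∀ j : ℤ, |j| ≤ N + n * M → h j = h' j) {j : ℤ} (hj : |j| ≤ N) :
    boxIter a h j = boxIter a h' j := by
  induction n generalizing N j with
  | zero => exact H j (by simpa using hj)
  | succ n ih =>
    rw [boxIter, boxIter, box, box]
    refine Finset.sum_congr rfl fun i hi => ?_
    refine ih (N := N + M) (fun i => ha i.succ) (fun k hk => H k (hk.trans_eq ?_)) ?_
    · push_cast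
      ring
    · have := Finset.mem_range.1 hi
      have := ha 0
      rw [abs_le] at hj ⊢
      omega

lemma boxIter_sum {ι : Type*} (S : Finset ι) (f : ι → ℤ → ℝ) (a : Fin n → ℕ) (j : ℤ) :
    boxIter a (fun j => ∑ l ∈ S, f l j) j = ∑ l ∈ S, boxIter a (f l) j := by
  induction n generalizing j with
  | zero => rfl
  | succ n ih =>
    simp only [boxIter, box, ih]
    exact Finset.sum_comm

lemma boxIter_sub (f g : ℤ → ℝ) (a : Fin n → ℕ) (j : ℤ) :
    boxIter a (fun j => f j - g j) j = boxIter a f j - boxIter a g j := by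
  induction n generalizing j with
  | zero => rfl
  | succ n ih => simp only [boxIter, box, ih, Finset.sum_sub_distrib]

lemma boxIter_const (c : ℝ) (a : Fin n → ℕ) (j : ℤ) :
    boxIter a (fun _ => c) j = (∏ i, (a i : ℝ)) * c := by
  induction n generalizing j with
  | zero => simp [boxIter]
  | succ n ih =>
    simp only [boxIter, box, ih, Fin.prod_univ_succ, Fin.tail, Finset.sum_const,
      Finset.card_range, nsmul_eq_mul]
    ring

lemma boxIter_comp_sub (f : ℤ → ℝ) (c : ℤ) (a : Fin n → ℕ) (j : ℤ) :
    boxIter a (fun j => f (j - c)) j = boxIter a f (j - c) := by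
  induction n generalizing j with
  | zero => rfl
  | succ n ih =>
    simp only [boxIter, box, ih]
    refine Finset.sum_congr rfl fun i _ => ?_
    congr 1
    ring

/-- The floor counts the l ≥ -N with 2pl ≤ j and the ceiling those with 2pl < j, up to constants. -/
lemma stair_eq_sum {p N : ℕ} (hp : 0 < p) {j : ℤ} (hj : |j| ≤ 2 * p * N) :
    stair p j = (∑ l ∈ Finset.Icc (-N : ℤ) N, unitStep (j - 2 * p * l)) - (2 * N + 1) := by
  have hp2 : (0 : ℤ) < 2 * p := by omega
  rw [abs_le] at hj
  have e₁ : ∑ l ∈ Finset.Icc (-N : ℤ) N, (if 0 ≤ j - 2 * p * l then (1 : ℝ) else 0) =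
      ((j / (2 * p) + N + 1 : ℤ) : ℝ) := by
    have hlo : -N ≤ j / (2 * p) := (Int.le_ediv_iff_mul_le hp2).2 (by linarith)
    have hhi : j / (2 * p) ≤ N := Int.ediv_le_of_le_mul hp2 (by linarith)
    have : {l ∈ Finset.Icc (-N : ℤ) N | 0 ≤ j - 2 * p * l} = Finset.Icc (-N : ℤ) (j / (2 * p)) := by
      ext l
      simp only [Finset.mem_filter, Finset.mem_Icc, Int.le_ediv_iff_mul_le hp2, sub_nonneg,
        mul_comm l]
      constructor
      · rintro ⟨⟨h₁, h₂⟩, h₃⟩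
        exact ⟨h₁, h₃⟩
      · rintro ⟨h₁, h₃⟩
        refine ⟨⟨h₁, ?_⟩, h₃⟩
        exact ((Int.le_ediv_iff_mul_le hp2).2 (by linarith)).trans hhi
    rw [Finset.sum_boole, this, Int.card_Icc, ← Int.cast_natCast, Int.toNat_of_nonneg (by omega)]
    push_cast
    ring
  have e₂ : ∑ l ∈ Finset.Icc (-N : ℤ) N, (if 0 < j - 2 * p * l then (1 : ℝ) else 0) =
      ((-(-j / (2 * p)) + N : ℤ) : ℝ) := by
    have hlo : -N ≤ -j / (2 * p) := (Int.le_ediv_iff_mul_le hp2).2 (by linarith)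
    have hhi : -j / (2 * p) ≤ N := Int.ediv_le_of_le_mul hp2 (by linarith)
    have : {l ∈ Finset.Icc (-N : ℤ) N | 0 < j - 2 * p * l} =
        Finset.Icc (-N : ℤ) (-(-j / (2 * p)) - 1) := by
      ext l
      have key : 0 < j - 2 * p * l ↔ -j / (2 * p) < -l := by
        rw [Int.ediv_lt_iff_lt_mul hp2]
        constructor <;> intro h <;> linarith
      simp only [Finset.mem_filter, Finset.mem_Icc, key]
      omega
    rw [Finset.sum_boole, this, Int.card_Icc, ← Int.cast_natCast, Int.toNat_of_nonneg (by omega)]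
    push_cast
    ring
  simp only [unitStep]
  rw [Finset.sum_add_distrib, e₁, e₂, stair]
  push_cast
  ring

end BoxApprox

/-! ### The function g as a finite sum. -/

section GFunction

variable {k : ℕ}

lemma zsmul_sum_eq (ε : Fin k → ℤˣ) (x : Fin k → ℝ) :
    ∑ i, (ε i : ℤ) • x i = ∑ i, ((ε i : ℤ) : ℝ) * x i := by
  simp [zsmul_eq_mul]

lemma abs_sum_units_mul_le (ε : Fin k → ℤˣ) {x : Fin k → ℝ} {B : ℝ} (hx : ∀ i, |x i| ≤ B) :
    |∑ i, ((ε i : ℤ) : ℝ) * x i| ≤ k * B := by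
  refine (Finset.abs_sum_le_sum_abs _ _).trans ?_
  refine (Finset.sum_le_card_nsmul _ _ B fun i _ => ?_).trans_eq (by simp)
  rcases Int.units_eq_one_or (ε i) with h | h <;> simpa [h] using hx i

lemma gTerm_eq_signSum (x : Fin (k + 1) → ℝ) (l : ℤ) :
    gTerm x l = 2 ^ k * k.factorial * (1 / 2 * signSum x (truncPow k) (-2 * l)) := by
  rw [gTerm, signSum, Finset.sum_filter, Finset.mul_sum, Finset.mul_sum]
  refine Finset.sum_congr rfl fun ε _ => ?_
  rw [zsmul_sum_eq, truncPow]
  have hf : (k.factorial : ℝ) ≠ 0 := by exact_mod_cast k.factorial_ne_zero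
  have hiff : 0 ≤ -2 * (l : ℝ) + ∑ i, ((ε i : ℤ) : ℝ) * x i ↔
      2 * (l : ℝ) ≤ ∑ i, ((ε i : ℤ) : ℝ) * x i := by
    constructor <;> intro h <;> linarith
  simp only [hiff]
  split_ifs
  · rw [Nat.add_sub_cancel, div_pow,
      show -2 * (l : ℝ) + ∑ i, ((ε i : ℤ) : ℝ) * x i =
        ∑ i, ((ε i : ℤ) : ℝ) * x i - 2 * l by ring]
    field_simp
  · simp

/-- For large l no sign vector qualifies. For very negative l all of them do, and the sum is a
(k+1)-fold difference of a polynomial of degree k. -/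
lemma gTerm_eq_zero {x : Fin (k + 1) → ℝ} (hx : ∀ i, |x i| ≤ 1) {l : ℤ}
    (hl : l ∉ Finset.Icc (-(k + 1 : ℕ) : ℤ) (k + 1 : ℕ)) : gTerm x l = 0 := by
  have hb : ∀ ε : Fin (k + 1) → ℤˣ, |∑ i, ((ε i : ℤ) : ℝ) * x i| ≤ (k + 1 : ℕ) := fun ε => by
    simpa using abs_sum_units_mul_le ε hx
  have hk : (0 : ℝ) ≤ (k + 1 : ℕ) := Nat.cast_nonneg _
  rw [Finset.mem_Icc, not_and_or, not_le, not_le] at hl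
  rcases hl with hl | hl
  · have hl' : (l : ℝ) < -(k + 1 : ℕ) := by exact_mod_cast hl
    have h := signSum_eval_eq_zero x (Polynomial.X ^ k)
      (by rw [Polynomial.degree_X_pow]; exact_mod_cast k.lt_succ_self) (-2 * l)
    rw [gTerm, ← h, signSum, Finset.filter_true_of_mem]
    · refine Finset.sum_congr rfl fun ε _ => ?_
      rw [zsmul_sum_eq, Polynomial.eval_pow, Polynomial.eval_X, Nat.add_sub_cancel]
      ring
    · intro ε _
      have := (abs_le.1 (hb ε)).1
      linarith
  · have hl' : ((k + 1 : ℕ) : ℝ) < l := by exact_mod_cast hl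
    rw [gTerm, Finset.filter_false_of_mem, Finset.sum_empty]
    intro ε _ h
    have := (abs_le.1 (hb ε)).2
    linarith

lemma g_eq_sum {x : Fin (k + 1) → ℝ} (hx : ∀ i, |x i| ≤ 1) :
    g x = 1 / 2 * ∑ l ∈ Finset.Icc (-(k + 1 : ℕ) : ℤ) (k + 1 : ℕ),
      signSum x (truncPow k) (-2 * l) := by
  rw [g, finsum_eq_sum_of_support_subset (s := Finset.Icc (-(k + 1 : ℕ) : ℤ) (k + 1 : ℕ))]
  · simp_rw [gTerm_eq_signSum, ← Finset.mul_sum, Nat.add_sub_cancel]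
    have hf : (k.factorial : ℝ) ≠ 0 := by exact_mod_cast k.factorial_ne_zero
    field_simp
  · intro l hl
    by_contra hcon
    exact hl (gTerm_eq_zero hx (by simpa using hcon))

/-- The case s = 1 stands apart: `truncPow 0` is a jump function, to which the Lipschitz estimate
does not apply. -/
lemma g_fin_one {x : ℝ} (hx : 0 < x) (hx1 : x ≤ 1) : g (fun _ : Fin 1 => x) = 1 := by
  have h : ∀ l : ℤ, gTerm (fun _ : Fin 1 => x) l =
      (if 0 ≤ -2 * (l : ℝ) + x then 1 else 0) - (if 0 ≤ -2 * (l : ℝ) - x then 1 else 0) := by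
    intro l
    rw [gTerm_eq_signSum, signSum_succ, signSum_fin_zero, signSum_fin_zero, truncPow, truncPow]
    split_ifs <;> simp
  have h0 : ∀ l : ℤ, l ≠ 0 → gTerm (fun _ : Fin 1 => x) l = 0 := by
    intro l hl
    rw [h]
    rcases hl.lt_or_gt with hl | hl
    · have : (l : ℝ) ≤ -1 := by exact_mod_cast Int.le_sub_one_of_lt hl
      rw [if_pos (by linarith), if_pos (by linarith), sub_self]
    · have : (1 : ℝ) ≤ l := by exact_mod_cast hl
      rw [if_neg (by linarith), if_neg (by linarith), sub_self]
  have h1 : gTerm (fun _ : Fin 1 => x) 0 = 1 := by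
    rw [h, if_pos (by simpa using hx.le), if_neg (by simpa using hx), sub_zero]
  rw [g, finsum_eq_single _ 0 h0, h1]
  simp

end GFunction

/-! ### Asymptotics of the linear case. -/

section LinNat

variable {n : ℕ}

lemma linNat_eq_sum (p : ℕ) [hp : Fact p.Prime] {K : Type*} [Field K] [CharP K p]
    {a : Fin (n + 1) → ℕ} (ha : ∀ i, a i ≤ p) :
    (linNat K a : ℝ) = 1 / 2 * ∑ l ∈ Finset.Icc (-(n + 1 : ℕ) : ℤ) (n + 1 : ℕ),
      (boxIter (Fin.tail a) unitStep (a 0 - 2 * p * l) -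
        boxIter (Fin.tail a) unitStep (-(a 0 : ℤ) - 2 * p * l)) := by
  have hpos := hp.out.pos
  have hh := (isReflective_stair hpos).boxIter (Fin.tail a)
  have h₁ : (linNat K a : ℝ) = boxIter (Fin.tail a) (stair p) (a 0) := by
    rw [linNat, diagDim_eq_splitDim]
    exact splitDim_eq_boxIter p _ (fun i => ha i.succ) _ (ha 0)
  -- Antisymmetrizing by oddness cancels the constant of `stair_eq_sum` and supplies the missing
  -- sign for the exponent a_0.
  have h₂ : (linNat K a : ℝ) = 1 / 2 *
      (boxIter (Fin.tail a) (stair p) (a 0) - boxIter (Fin.tail a) (stair p) (-(a 0 : ℤ))) := by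
    rw [hh.odd, h₁]
    ring
  have h₃ : ∀ j : ℤ, |j| ≤ p → boxIter (Fin.tail a) (stair p) j =
      ∑ l ∈ Finset.Icc (-(n + 1 : ℕ) : ℤ) (n + 1 : ℕ),
        boxIter (Fin.tail a) unitStep (j - 2 * p * l) -
          (∏ i, (Fin.tail a i : ℝ)) * (2 * (n + 1 : ℕ) + 1) := by
    intro j hj
    rw [boxIter_congr (h := stair p) (a := Fin.tail a) (N := p) (M := p) (fun i => ha i.succ)
      (fun k hk => stair_eq_sum (N := n + 1) hpos (hk.trans ?_)) hj, boxIter_sub, boxIter_sum,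
      boxIter_const]
    · simp only [boxIter_comp_sub]
    · push_cast
      nlinarith
  have ha0 := ha 0
  rw [h₂, h₃ _ (by simpa using ha0), h₃ _ (by simpa using ha0), Finset.sum_sub_distrib]
  ring

theorem exists_abs_linNat_sub_le (n : ℕ) : ∃ C : ℝ, 0 ≤ C ∧ ∀ (p : ℕ) [Fact p.Prime]
    (K : Type) [Field K] [CharP K p] (a : Fin (n + 2) → ℕ) (x : Fin (n + 2) → ℝ),
    (∀ i, a i ≤ p) → (∀ i, |x i| ≤ 1) → (∀ i, |(a i : ℝ) - p * x i| ≤ 1) →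
    |(linNat K a : ℝ) - p ^ (n + 1) * g x| ≤ C * p ^ n := by
  -- The box sums are evaluated at ±a_0 - 2pl with |l| ≤ n + 2, so at distance at most (2(n+2) + 1)p
  -- from 0.
  obtain ⟨C₁, hC₁, h₁⟩ := exists_abs_boxIter_sub_signSum_le n (2 * (n + 2) + 1)
  -- Cost of replacing a by px: 2^(n+2) sign vectors, arguments bounded by 3(n+2)p and differing by
  -- at most n + 2.
  set C₂ : ℝ := 2 ^ (n + 2) * (2 * (n + 1) * (n + 2) * (3 * (n + 2)) ^ n)
  refine ⟨(2 * (n + 2) + 1) * (C₁ + C₁ + C₂), by positivity, fun p hp K _ _ a x ha hx hax => ?_⟩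
  have hpos : 0 < p := hp.out.pos
  have hpR : (0 : ℝ) < p := by exact_mod_cast hpos
  have ha' : ∀ i, (a i : ℝ) ≤ p := fun i => by exact_mod_cast ha i
  rw [linNat_eq_sum p ha, g_eq_sum hx, mul_left_comm, ← mul_sub, Finset.mul_sum,
    ← Finset.sum_sub_distrib, abs_mul, abs_of_pos (by norm_num : (0 : ℝ) < 1 / 2)]
  have hterm : ∀ l ∈ Finset.Icc (-(n + 1 + 1 : ℕ) : ℤ) (n + 1 + 1 : ℕ),
      |boxIter (Fin.tail a) unitStep (a 0 - 2 * p * l) -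
        boxIter (Fin.tail a) unitStep (-(a 0 : ℤ) - 2 * p * l) -
        p ^ (n + 1) * signSum x (truncPow (n + 1)) (-2 * l)| ≤ (C₁ + C₁ + C₂) * p ^ n := by
    intro l hl
    rw [Finset.mem_Icc] at hl
    have hl' : |(l : ℝ)| ≤ n + 2 := by
      rw [abs_le]
      constructor
      · exact_mod_cast hl.1
      · exact_mod_cast hl.2
    have hl2 := abs_le.1 hl'
    set f : ℤ → ℝ := fun y => truncPow (n + 1) y
    set T' : Fin (n + 1) → ℤ := fun i => (Fin.tail a i : ℤ)
    set a' : Fin (n + 2) → ℤ := fun i => (a i : ℤ)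
    have e₁ : |boxIter (Fin.tail a) unitStep (a 0 - 2 * p * l) -
        signSum T' f (a 0 - 2 * p * l)| ≤ C₁ * p ^ n := by
      refine h₁ p _ _ hpos (fun i => ha i.succ) ?_
      have := ha' 0
      have h0 : (0 : ℝ) ≤ a 0 := Nat.cast_nonneg _
      push_cast
      rw [abs_le]
      constructor <;> nlinarith
    have e₂ : |boxIter (Fin.tail a) unitStep (-(a 0 : ℤ) - 2 * p * l) -
        signSum T' f (-(a 0 : ℤ) - 2 * p * l)| ≤ C₁ * p ^ n := by
      refine h₁ p _ _ hpos (fun i => ha i.succ) ?_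
      have := ha' 0
      have h0 : (0 : ℝ) ≤ a 0 := Nat.cast_nonneg _
      push_cast
      rw [abs_le]
      constructor <;> nlinarith
    have e₃ : signSum T' f (a 0 - 2 * p * l) - signSum T' f (-(a 0 : ℤ) - 2 * p * l) =
        signSum a' f (-2 * p * l) := by
      rw [signSum_succ a', show -2 * p * l + a' 0 = a 0 - 2 * p * l by simp only [a']; ring,
        show -2 * p * l - a' 0 = -(a 0 : ℤ) - 2 * p * l by simp only [a']; ring]
      rfl
    have e₄ : |signSum a' f (-2 * p * l) -
        p ^ (n + 1) * signSum x (truncPow (n + 1)) (-2 * l)| ≤ C₂ * p ^ n := by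
      rw [signSum, signSum, Finset.mul_sum, ← Finset.sum_sub_distrib]
      refine (Finset.abs_sum_le_sum_abs _ _).trans ((Finset.sum_le_card_nsmul _ _
        (2 * (n + 1) * (n + 2) * (3 * (n + 2) * p) ^ n : ℝ) fun ε _ => ?_).trans_eq ?_)
      · rw [zsmul_sum_eq, mul_left_comm, ← mul_sub, abs_mul, abs_units_prod, one_mul,
          ← truncPow_mul _ hpR]
        have hs : |∑ i, ((ε i : ℤ) : ℝ) * ((a i : ℝ) - p * x i)| ≤ (n + 2 : ℕ) * 1 :=
          abs_sum_units_mul_le ε hax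
        have hsa : |∑ i, ((ε i : ℤ) : ℝ) * (a i : ℝ)| ≤ (n + 2 : ℕ) * p :=
          abs_sum_units_mul_le ε fun i => by simpa using ha i
        have hsx : |∑ i, ((ε i : ℤ) : ℝ) * x i| ≤ (n + 2 : ℕ) * 1 :=
          abs_sum_units_mul_le ε hx
        have hcast : ((-2 * p * l + ∑ i, (ε i : ℤ) • a' i : ℤ) : ℝ) =
            -2 * p * l + ∑ i, ((ε i : ℤ) : ℝ) * (a i : ℝ) := by
          simp [a']
        have hdiff : (-2 * p * l + ∑ i, ((ε i : ℤ) : ℝ) * (a i : ℝ)) -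
            p * (-2 * l + ∑ i, ((ε i : ℤ) : ℝ) * x i) =
            ∑ i, ((ε i : ℤ) : ℝ) * ((a i : ℝ) - p * x i) := by
          simp only [mul_sub, Finset.sum_sub_distrib, mul_left_comm _ (p : ℝ), ← Finset.mul_sum]
          ring
        simp only [f, hcast]
        push_cast at hs hsa hsx
        refine (abs_truncPow_succ_sub_le n (B := 3 * (n + 2) * p) ?_ ?_).trans ?_
        · rw [abs_le] at hsa ⊢
          constructor <;> nlinarith
        · rw [abs_mul, abs_of_pos hpR, mul_comm]
          gcongr
          rw [abs_le] at hsx ⊢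
          constructor <;> linarith
        · rw [hdiff]
          gcongr
          linarith
      · simp [C₂, mul_pow]
        ring
    rw [← e₃] at e₄
    rw [add_mul, add_mul]
    rw [abs_le] at e₁ e₂ e₄ ⊢
    constructor <;> linarith [e₁.1, e₁.2, e₂.1, e₂.2, e₄.1, e₄.2]
  have hsum := (Finset.abs_sum_le_sum_abs _ _).trans (Finset.sum_le_card_nsmul _ _ _ hterm)
  rw [Int.card_Icc, nsmul_eq_mul] at hsum
  have hc : (((n + 1 + 1 : ℕ) : ℤ) + 1 - -((n + 1 + 1 : ℕ) : ℤ)).toNat = 2 * (n + 2) + 1 := by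
    omega
  rw [hc] at hsum
  push_cast at hsum ⊢
  have h0 := abs_nonneg (∑ l ∈ Finset.Icc (-(n + 1 + 1 : ℤ)) (n + 1 + 1),
      (boxIter (Fin.tail a) unitStep (a 0 - 2 * p * l) -
        boxIter (Fin.tail a) unitStep (-(a 0 : ℤ) - 2 * p * l) -
        p ^ (n + 1) * signSum x (truncPow (n + 1)) (-2 * l)))
  rw [mul_assoc]
  linarith

end LinNat

/-! ### Convergence of the normalized dimensions, uniformly in p. -/

section Normalized

/-- The normalized dimension of `𝔽_p[x] / (x_i ^ (p ^ m), ∑ x_i ^ d_i)`. -/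
def diagRatio {s : ℕ} (d : Fin s → ℕ) (p : ℕ) [Fact p.Prime] (m : ℕ) : ℝ :=
  (diagNat (ZMod p) d (p ^ m) : ℝ) / ((p : ℝ) ^ m) ^ (s - 1)

lemma diagNat_fin_one_le {K : Type*} [Field K] {d : Fin 1 → ℕ} (hd : ∀ i, 2 ≤ d i) (q : ℕ) :
    diagNat K d q ≤ d 0 := by
  have h := diagNat_le_linNat (K := K) (d := d) (a := fun _ => q / d 0 + 1) (q := q)
    (fun i => by have := hd i; omega) fun i => by
      rw [Fin.fin_one_eq_zero i]
      exact (Nat.lt_mul_div_succ q (by have := hd 0; omega)).le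
  rw [linNat_fin_one (by simp)] at h
  simpa using h

lemma diagNat_fin_one {K : Type*} [Field K] {d : Fin 1 → ℕ} (hd : ∀ i, 2 ≤ d i) {q : ℕ}
    (hq : d 0 ≤ q) : diagNat K d q = d 0 := by
  refine (diagNat_fin_one_le hd q).antisymm ?_
  have h := linNat_le_diagNat (K := K) (d := d) (a := fun _ => 1) (q := q)
    (fun i => by have := hd i; omega) fun i => by
      rw [Fin.fin_one_eq_zero i]
      simpa using hq
  rw [linNat_fin_one (by simp)] at h
  simpa using h

lemma exists_abs_diagRatio_succ_sub_le {s : ℕ} (hs : 1 ≤ s) {d : Fin s → ℕ}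
    (hd : ∀ i, 2 ≤ d i) : ∃ C : ℝ, 0 ≤ C ∧ ∀ (p : ℕ) [Fact p.Prime] (m : ℕ),
      |diagRatio d p (m + 1) - diagRatio d p m| ≤ C / p ^ m := by
  obtain ⟨s, rfl⟩ := Nat.exists_eq_add_of_le' hs
  rcases s with _ | n
  · refine ⟨(d 0 : ℝ) * d 0, by positivity, fun p hp m => ?_⟩
    have hpR : (0 : ℝ) < p := by exact_mod_cast hp.out.pos
    simp only [diagRatio, zero_add, Nat.sub_self, pow_zero, div_one]
    by_cases hq : d 0 ≤ p ^ m
    · rw [diagNat_fin_one hd hq, diagNat_fin_one hd (hq.trans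
        (Nat.pow_le_pow_right hp.out.pos m.le_succ)), sub_self, abs_zero]
      positivity
    · have h₁ : (diagNat (ZMod p) d (p ^ (m + 1)) : ℝ) ≤ d 0 := by
        exact_mod_cast diagNat_fin_one_le hd _
      have h₂ : (diagNat (ZMod p) d (p ^ m) : ℝ) ≤ d 0 := by
        exact_mod_cast diagNat_fin_one_le hd _
      have h₃ : (p : ℝ) ^ m ≤ d 0 := by exact_mod_cast (not_le.1 hq).le
      have h₄ : |(diagNat (ZMod p) d (p ^ (m + 1)) : ℝ) - diagNat (ZMod p) d (p ^ m)| ≤ d 0 := by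
        rw [abs_le]
        constructor <;> linarith [Nat.cast_nonneg (α := ℝ) (diagNat (ZMod p) d (p ^ (m + 1))),
          Nat.cast_nonneg (α := ℝ) (diagNat (ZMod p) d (p ^ m))]
      refine h₄.trans ?_
      rw [le_div_iff₀ (by positivity)]
      gcongr
  · refine ⟨(∏ i, d i : ℕ) * ((n + 2) * 2 ^ n), by positivity, fun p hp m => ?_⟩
    have hpR : (0 : ℝ) < p := by exact_mod_cast hp.out.pos
    have h := abs_diagNat_sub_le (K := ZMod p) p (d := d) (q := p ^ m)
      (fun i => by have := hd i; omega) (Nat.one_le_pow _ _ hp.out.pos)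
    have e : diagRatio d p (m + 1) - diagRatio d p m =
        ((diagNat (ZMod p) d (p * p ^ m) : ℝ) - p ^ (n + 1) * diagNat (ZMod p) d (p ^ m)) /
          (p * (p : ℝ) ^ m) ^ (n + 1) := by
      rw [diagRatio, diagRatio, ← pow_succ', ← pow_succ']
      simp only [Nat.add_sub_cancel]
      rw [pow_succ (p : ℝ) m, mul_pow]
      field_simp
    rw [e, abs_div, abs_of_pos (by positivity : (0 : ℝ) < (p * (p : ℝ) ^ m) ^ (n + 1)),
      div_le_iff₀ (by positivity)]
    refine h.trans_eq ?_
    push_cast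
    rw [mul_assoc 2 (p : ℝ), mul_pow 2, pow_succ (p * (p : ℝ) ^ m)]
    field_simp

lemma exists_abs_diagRatio_one_sub_le {s : ℕ} (hs : 1 ≤ s) {d : Fin s → ℕ}
    (hd : ∀ i, 2 ≤ d i) : ∃ C : ℝ, 0 ≤ C ∧ ∀ (p : ℕ) [Fact p.Prime],
      |diagRatio d p 1 - (∏ i, (d i : ℝ)) * g (fun i => 1 / (d i : ℝ))| ≤ C / p := by
  have hdR : ∀ i, (2 : ℝ) ≤ d i := fun i => by exact_mod_cast hd i
  have hx0 : ∀ i, 0 < 1 / (d i : ℝ) := fun i => by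
    have := hdR i
    positivity
  have hx1 : ∀ i, 1 / (d i : ℝ) ≤ 1 := fun i => by
    rw [div_le_one (by linarith [hdR i])]
    linarith [hdR i]
  obtain ⟨s, rfl⟩ := Nat.exists_eq_add_of_le' hs
  rcases s with _ | n
  · refine ⟨(d 0 : ℝ) * d 0, by positivity, fun p hp => ?_⟩
    have hpR : (0 : ℝ) < p := by exact_mod_cast hp.out.pos
    have hg : g (fun i => 1 / (d i : ℝ)) = 1 := by
      have : (fun i => 1 / (d i : ℝ)) = fun _ => 1 / (d 0 : ℝ) := by
        ext i
        rw [Fin.fin_one_eq_zero i]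
      rw [this]
      exact g_fin_one (hx0 0) (hx1 0)
    have hprod : ∏ i, (d i : ℝ) = d 0 := Fin.prod_univ_one _
    rw [hg, hprod]
    simp only [diagRatio, zero_add, Nat.sub_self, pow_zero, div_one, pow_one, mul_one]
    by_cases hq : d 0 ≤ p
    · rw [diagNat_fin_one hd hq, sub_self, abs_zero]
      positivity
    · have h₁ : (diagNat (ZMod p) d p : ℝ) ≤ d 0 := by
        exact_mod_cast diagNat_fin_one_le hd _
      have h₃ : (p : ℝ) ≤ d 0 := by exact_mod_cast (not_le.1 hq).le
      have h₄ : |(diagNat (ZMod p) d p : ℝ) - d 0| ≤ d 0 := by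
        rw [abs_le]
        constructor <;> linarith [Nat.cast_nonneg (α := ℝ) (diagNat (ZMod p) d p)]
      refine h₄.trans ?_
      rw [le_div_iff₀ hpR]
      gcongr
  · obtain ⟨C, hC, h⟩ := exists_abs_linNat_sub_le n
    refine ⟨(∏ i, (d i : ℝ)) * C, by positivity, fun p hp => ?_⟩
    have hpR : (0 : ℝ) < p := by exact_mod_cast hp.out.pos
    have hd0 : ∀ i, 0 < d i := fun i => by have := hd i; omega
    set x : Fin (n + 2) → ℝ := fun i => 1 / (d i : ℝ)
    have hx : ∀ i, |x i| ≤ 1 := fun i => by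
      rw [abs_of_pos (hx0 i)]
      exact hx1 i
    have hlo : ∀ i, ((p / d i : ℕ) : ℝ) ≤ p * x i := fun i => by
      simpa [x, div_eq_mul_inv] using Nat.cast_div_le (α := ℝ) (m := p) (n := d i)
    have hhi : ∀ i, p * x i ≤ ((p / d i : ℕ) : ℝ) + 1 := fun i => by
      have : (p : ℝ) ≤ d i * ((p / d i : ℕ) + 1) := by
        exact_mod_cast (Nat.lt_mul_div_succ p (hd0 i)).le
      simp only [x, mul_one_div]
      rw [div_le_iff₀ (by linarith [hdR i])]
      linarith
    have h₁ := h p (ZMod p) (fun i => p / d i) x (fun i => Nat.div_le_self _ _) hx fun i => by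
      rw [abs_le]
      constructor <;> linarith [hlo i, hhi i]
    -- Here d_i ≥ 2 matters: it keeps ⌊p/d_i⌋ + 1 at most p, within the range of the exact formula.
    have h₂ := h p (ZMod p) (fun i => p / d i + 1) x
      (fun i => Nat.div_lt_self hp.out.pos (hd i)) hx fun i => by
        rw [abs_le]
        push_cast
        constructor <;> linarith [hlo i, hhi i]
    have h₃ := linNat_le_diagNat (K := ZMod p) hd0 (a := fun i => p / d i) (q := p)
      fun i => Nat.mul_div_le p (d i)
    have h₄ := diagNat_le_linNat (K := ZMod p) hd0 (a := fun i => p / d i + 1) (q := p)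
      fun i => (Nat.lt_mul_div_succ p (hd0 i)).le
    rify at h₃ h₄
    set D := ∏ i, (d i : ℝ)
    have hD : 0 ≤ D := by positivity
    have e : diagRatio d p 1 - D * g x =
        ((diagNat (ZMod p) d p : ℝ) - D * (p ^ (n + 1) * g x)) / p ^ (n + 1) := by
      rw [diagRatio]
      simp only [pow_one, Nat.add_sub_cancel]
      field_simp
    rw [e, abs_div, abs_of_pos (by positivity : (0 : ℝ) < (p : ℝ) ^ (n + 1)),
      div_le_iff₀ (by positivity)]
    have e₂ : D * C / p * p ^ (n + 1) = D * (C * p ^ n) := by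
      rw [pow_succ]
      field_simp
    rw [e₂]
    have h₅ := mul_le_mul_of_nonneg_left (abs_le.1 h₁).1 hD
    have h₆ := mul_le_mul_of_nonneg_left (abs_le.1 h₂).2 hD
    rw [abs_le]
    constructor <;> linarith

lemma exists_tendsto_diagRatio {s : ℕ} (hs : 1 ≤ s) {d : Fin s → ℕ} (hd : ∀ i, 2 ≤ d i) :
    ∃ C : ℝ, 0 ≤ C ∧ ∀ (p : ℕ) [Fact p.Prime], ∃ e : ℝ,
      Tendsto (diagRatio d p) atTop (𝓝 e) ∧ ∀ m, |diagRatio d p m - e| ≤ C / p ^ m := by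
  obtain ⟨C, hC, h⟩ := exists_abs_diagRatio_succ_sub_le hs hd
  refine ⟨2 * C, by positivity, fun p hp => ?_⟩
  have hp2 : (2 : ℝ) ≤ p := by exact_mod_cast hp.out.two_le
  have hr : (1 : ℝ) / p < 1 := by
    rw [div_lt_one (by linarith)]
    linarith
  have hdist : ∀ m, dist (diagRatio d p m) (diagRatio d p (m + 1)) ≤ C * (1 / p : ℝ) ^ m := by
    intro m
    rw [dist_comm, Real.dist_eq, one_div, inv_pow, ← div_eq_mul_inv]
    exact h p m
  obtain ⟨e, he⟩ := cauchySeq_tendsto_of_complete (cauchySeq_of_le_geometric _ C hr hdist)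
  refine ⟨e, he, fun m => ?_⟩
  have := dist_le_of_le_geometric_of_tendsto _ C hr hdist he m
  rw [Real.dist_eq] at this
  refine this.trans ?_
  have h1 : (1 : ℝ) / 2 ≤ 1 - 1 / p := by
    have : (1 : ℝ) / p ≤ 1 / 2 := by gcongr
    linarith
  calc C * (1 / p : ℝ) ^ m / (1 - 1 / p) ≤ C * (1 / p : ℝ) ^ m / (1 / 2) := by gcongr
    _ = _ := by
      rw [one_div, inv_pow]
      field_simp

end Normalized

/-! ### Length over a ring versus dimension over the field. -/

section LengthComparison

variable {K A M : Type*} [Field K] [CommRing A] [Algebra K A] [AddCommGroup M] [Module K M]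
  [Module A M] [IsScalarTower K A M]

/-- A Nakayama argument: otherwise N' = N + xN', and iterating gives N' = N + x^k N' = N. -/
lemma smul_mem_of_covBy {N N' : Submodule A M} (h : N ⋖ N') {x : A} {k : ℕ}
    (hx : ∀ m : M, x ^ k • m = 0) {m : M} (hm : m ∈ N') : x • m ∈ N := by
  by_contra hcon
  let φ : M →ₗ[A] M := LinearMap.lsmul A M x
  have hle : N ⊔ N'.map φ ≤ N' := by
    refine sup_le h.le ?_
    rintro _ ⟨y, hy, rfl⟩
    exact N'.smul_mem x hy
  have hlt : N < N ⊔ N'.map φ := by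
    refine lt_of_le_of_ne le_sup_left fun he => hcon ?_
    rw [he]
    exact Submodule.mem_sup_right ⟨m, hm, rfl⟩
  have heq : N ⊔ N'.map φ = N' := hle.eq_of_not_lt fun hlt' => h.2 hlt hlt'
  have hpow : ∀ j : ℕ, ∀ y ∈ N', ∃ z ∈ N', y - x ^ j • z ∈ N := by
    intro j
    induction j with
    | zero => exact fun y hy => ⟨y, hy, by simp⟩
    | succ j ih =>
      intro y hy
      obtain ⟨z, hz, hyz⟩ := ih y hy
      rw [← heq] at hz
      obtain ⟨u, hu, _, ⟨w, hw, rfl⟩, rfl⟩ := Submodule.mem_sup.1 hz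
      refine ⟨w, hw, ?_⟩
      have := N.add_mem hyz (N.smul_mem (x ^ j) hu)
      convert this using 1
      simp only [φ, LinearMap.lsmul_apply, smul_add, pow_succ, mul_smul]
      abel
  refine h.lt.not_ge fun y hy => ?_
  obtain ⟨z, -, hyz⟩ := hpow k y hy
  simpa [hx] using hyz

/-- If `A = K + 𝔪` and the elements of `𝔪` act nilpotently on `M`, then the length of `M` over `A`
is its dimension over `K`. -/
lemma length_eq_length_of_nilpotent (𝔪 : Ideal A) (h𝔪 : ∀ x : A, ∃ c : K, x - algebraMap K A c ∈ 𝔪)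
    (hnil : ∀ x ∈ 𝔪, ∃ k : ℕ, ∀ m : M, x ^ k • m = 0) (hfin : Module.length K M ≠ ⊤) :
    Module.length A M = Module.length K M := by
  have hle : Module.length A M ≤ Module.length K M := by
    have := Submodule.length_le_length_restrictScalars (R := A) K (⊤ : Submodule A M)
    rwa [Module.length_top, Submodule.restrictScalars_top, Module.length_top] at this
  obtain ⟨s, hs₁, hs₂⟩ := isFiniteLength_iff_exists_compositionSeries.1
    (Module.length_ne_top_iff.1 (ne_top_of_le_ne_top hfin hle))
  -- A composition series over A is also one over K: a K-subspace between consecutive terms is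
  -- A-stable, since A = K + 𝔪 and 𝔪 maps each term into the preceding one.
  let t : CompositionSeries (Submodule K M) := s.map
    ⟨Submodule.restrictScalars K, fun {N N'} h => by
      refine ⟨(Submodule.restrictScalars_lt K).2 h.lt, fun L hL hL' => ?_⟩
      let L' : Submodule A M :=
        { L with
          smul_mem' := fun x m hm => by
            obtain ⟨c, hc⟩ := h𝔪 x
            obtain ⟨k, hk⟩ := hnil _ hc
            have h₁ := hL.le (smul_mem_of_covBy h hk (hL'.le hm))
            have h₂ := L.add_mem h₁ (L.smul_mem c hm)
            rw [sub_smul, algebraMap_smul, sub_add_cancel] at h₂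
            exact h₂ }
      exact h.2 (c := L') hL hL'⟩
  rw [← Module.length_compositionSeries s hs₁ hs₂, ← Module.length_compositionSeries t]
  · rfl
  · change Submodule.restrictScalars K s.head = ⊥
    rw [hs₁, Submodule.restrictScalars_bot]
  · change Submodule.restrictScalars K s.last = ⊤
    rw [hs₂, Submodule.restrictScalars_top]

lemma colength_comap_of_surjective {A B : Type*} [CommRing A] [CommRing B] (φ : B →+* A)
    (hφ : Function.Surjective φ) (J : Ideal A) : colength (J.comap φ) = colength J := by
  let := φ.toAlgebra
  rw [colength, colength, ← Module.length_eq_of_surjective (S := B) (R := A) hφ]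
  let f : B →ₗ[B] A ⧸ J := (Ideal.Quotient.mkₐ B J).toLinearMap ∘ₗ Algebra.linearMap B A
  have hf : Function.Surjective f := Ideal.Quotient.mk_surjective.comp hφ
  have hk : LinearMap.ker f = J.comap φ := by
    ext x
    exact Ideal.Quotient.eq_zero_iff_mem
  rw [← (f.quotKerEquivOfSurjective hf).length_eq, hk]

end LengthComparison

/-! ### Length and Krull dimension for polynomial quotients. -/

section Polynomial

open MvPolynomial

variable {K : Type*} [Field K] {n : ℕ}

lemma exists_pow_mem_of_powIdeal_le {a : Fin n → ℕ} {J : Ideal (MvPolynomial (Fin n) K)}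
    (hJ : powIdeal K a ≤ J) {x : MvPolynomial (Fin n) K}
    (hx : x ∈ powIdeal K (1 : Fin n → ℕ)) : ∃ k, x ^ k ∈ J := by
  have : powIdeal K (1 : Fin n → ℕ) ≤ J.radical := by
    refine Ideal.span_le.2 ?_
    rintro _ ⟨i, rfl⟩
    exact ⟨a i, by simpa using hJ (X_pow_mem_powIdeal le_rfl)⟩
  exact this hx

lemma colength_eq_quotDim {a : Fin n → ℕ} {J : Ideal (MvPolynomial (Fin n) K)}
    (hJ : powIdeal K a ≤ J) : colength J = quotDim K J := by
  refine length_eq_length_of_nilpotent (powIdeal K (1 : Fin n → ℕ))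
    (fun x => ⟨constantCoeff x, sub_C_mem_powIdeal_one x⟩) (fun x hx => ?_) ?_
  · obtain ⟨k, hk⟩ := exists_pow_mem_of_powIdeal_le hJ hx
    refine ⟨k, fun m => ?_⟩
    obtain ⟨m, rfl⟩ := Ideal.Quotient.mk_surjective m
    exact Ideal.Quotient.eq_zero_iff_mem.2 (J.mul_mem_right m hk)
  · refine ne_top_of_le_ne_top (ENat.natCast_ne_top (∏ i, a i)) ?_
    rw [← quotDim_powIdeal (K := K)]
    exact quotDim_anti hJ

/-- The prime ideal generated by the first `k` variables. -/
def firstVars (K : Type*) [Field K] (n k : ℕ) : Ideal (MvPolynomial (Fin n) K) :=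
  RingHom.ker (aeval fun i : Fin n => if (i : ℕ) < k then 0 else X i :
    MvPolynomial (Fin n) K →ₐ[K] MvPolynomial (Fin n) K)

instance (k : ℕ) : (firstVars K n k).IsPrime := RingHom.ker_isPrime _

lemma firstVars_lt {k : ℕ} (hk : k < n) : firstVars K n k < firstVars K n (k + 1) := by
  refine lt_of_le_of_ne (fun x hx => ?_) fun h => ?_
  · have hc : (aeval fun i : Fin n => if (i : ℕ) < k + 1 then 0 else X i :
        MvPolynomial (Fin n) K →ₐ[K] MvPolynomial (Fin n) K).comp
          (aeval fun i : Fin n => if (i : ℕ) < k then 0 else X i) =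
        aeval fun i : Fin n => if (i : ℕ) < k + 1 then 0 else X i := by
      refine algHom_ext fun i => ?_
      by_cases hi : (i : ℕ) < k
      · simp [hi, hi.not_gt]
      · simp [hi]
    have hx' : aeval (fun i : Fin n => if (i : ℕ) < k then 0 else X i) x =
      (0 : MvPolynomial (Fin n) K) := hx
    change aeval (fun i : Fin n => if (i : ℕ) < k + 1 then 0 else X i) x = _
    rw [← hc, AlgHom.comp_apply, hx', map_zero]
  · have h₁ : (X ⟨k, hk⟩ : MvPolynomial (Fin n) K) ∈ firstVars K n (k + 1) := by
      simp [firstVars, RingHom.mem_ker]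
    rw [← h] at h₁
    simp [firstVars, RingHom.mem_ker] at h₁

lemma le_height_firstVars {k : ℕ} (hk : k ≤ n) : (k : ℕ∞) ≤ (firstVars K n k).height := by
  induction k with
  | zero => simp
  | succ k ih =>
    refine le_trans ?_ (Ideal.height_add_one_le_of_lt_of_isPrime (firstVars_lt (K := K) hk))
    push_cast
    gcongr
    exact ih (by omega)

lemma sum_X_pow_ne_zero {d : Fin (n + 1) → ℕ} (hd : ∀ i, 0 < d i) :
    (∑ i, X i ^ d i : MvPolynomial (Fin (n + 1)) K) ≠ 0 := by
  intro h
  have := congrArg (aeval (Pi.single 0 1 : Fin (n + 1) → K)) h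
  simp [Fin.sum_univ_succ, (hd _).ne'] at this

/-- The form is a nonzerodivisor contained in the ideal of all variables, whose height is the full
dimension, so the quotient loses exactly one dimension. -/
lemma ringKrullDim_diagonal {d : Fin (n + 1) → ℕ} (hd : ∀ i, 0 < d i) :
    ringKrullDim (MvPolynomial (Fin (n + 1)) K ⧸
      Ideal.span {∑ i, (X i : MvPolynomial (Fin (n + 1)) K) ^ d i}) = n := by
  have hdim : ringKrullDim (MvPolynomial (Fin (n + 1)) K) = (n + 1 : ℕ) := by
    rw [MvPolynomial.ringKrullDim_of_isNoetherianRing, ringKrullDim_eq_zero_of_field]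
    simp
  have hheight : ((firstVars K (n + 1) (n + 1)).height : WithBot ℕ∞) =
      ringKrullDim (MvPolynomial (Fin (n + 1)) K) := by
    refine le_antisymm (Ideal.height_le_ringKrullDim_of_ne_top Ideal.IsPrime.ne_top') ?_
    rw [hdim]
    exact_mod_cast le_height_firstVars (K := K) le_rfl
  have := Module.ringKrullDim_quotient_add_one_of_mem_nonZeroDivisors
    (mem_nonZeroDivisors_of_ne_zero (sum_X_pow_ne_zero (K := K) hd)) hheight (by
      simp only [firstVars, RingHom.mem_ker, map_sum, map_pow, aeval_X]
      exact Finset.sum_eq_zero fun i _ => by simp [(hd i).ne', Nat.lt_succ_iff.1 i.2])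
  rw [hdim] at this
  have key : ∀ x : WithBot ℕ∞, x + 1 = (n + 1 : ℕ) → x = n := by
    intro x hx
    cases x with
    | bot => exact absurd hx (WithBot.bot_ne_coe (a := ((n + 1 : ℕ) : ℕ∞)))
    | coe x =>
      have hx' : x + 1 = (n : ℕ∞) + 1 := WithBot.coe_injective hx
      rw [ENat.add_left_injective_of_ne_top ENat.one_ne_top hx']
      rfl
  exact key _ this

end Polynomial

/-! ### Reduction modulo p as a quotient of a polynomial ring over 𝔽_p. -/

section Reduction

open MvPolynomial

variable {s : ℕ} (d : Fin s → ℕ) (p : ℕ)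

/-- The diagonal hypersurface ring over `𝔽_p`. -/
abbrev DiagonalRingMod : Type :=
  MvPolynomial (Fin s) (ZMod p) ⧸
    Ideal.span {∑ i, (X i : MvPolynomial (Fin s) (ZMod p)) ^ d i}

/-- Reduction of the coefficients modulo `p`. -/
def toDiagonalRingMod : MvPolynomial (Fin s) ℤ →+* DiagonalRingMod d p :=
  (Ideal.Quotient.mk _).comp (MvPolynomial.map (Int.castRingHom (ZMod p)))

lemma toDiagonalRingMod_surjective : Function.Surjective (toDiagonalRingMod d p) :=
  Ideal.Quotient.mk_surjective.comp
    (MvPolynomial.map_surjective _ (ZMod.ringHom_surjective _))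

lemma ker_toDiagonalRingMod : RingHom.ker (toDiagonalRingMod d p) =
    Ideal.span {∑ i, (X i : MvPolynomial (Fin s) ℤ) ^ d i} ⊔ Ideal.span {(p : MvPolynomial _ ℤ)} := by
  have h₁ : RingHom.ker (toDiagonalRingMod d p) =
      (Ideal.span {∑ i, (X i : MvPolynomial (Fin s) (ZMod p)) ^ d i}).comap
        (MvPolynomial.map (Int.castRingHom (ZMod p))) := by
    rw [toDiagonalRingMod, ← RingHom.comap_ker, Ideal.mk_ker]
  have h₂ : Ideal.span {∑ i, (X i : MvPolynomial (Fin s) (ZMod p)) ^ d i} =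
      (Ideal.span {∑ i, (X i : MvPolynomial (Fin s) ℤ) ^ d i}).map
        (MvPolynomial.map (Int.castRingHom (ZMod p))) := by
    rw [Ideal.map_span]
    simp
  have h₃ : Function.Surjective
      (MvPolynomial.map (Int.castRingHom (ZMod p)) : MvPolynomial (Fin s) ℤ →+* _) :=
    MvPolynomial.map_surjective _ (ZMod.ringHom_surjective _)
  rw [h₁, h₂, Ideal.comap_map_of_surjective' _ h₃, ker_map, ZMod.ker_intCastRingHom,
    Ideal.map_span]
  simp

/-- The reduction of the diagonal hypersurface ring is the diagonal hypersurface ring over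
`𝔽_p`. -/
def reductionEquiv : Reduction (DiagonalRing d) p ≃+* DiagonalRingMod d p :=
  ((DoubleQuot.quotQuotEquivQuotSup (Ideal.span {∑ i, (X i : MvPolynomial (Fin s) ℤ) ^ d i})
    (Ideal.span {(p : MvPolynomial (Fin s) ℤ)})).symm.trans
      (Ideal.quotEquivOfEq (by rw [Ideal.map_span]; simp))).symm.trans
    ((Ideal.quotEquivOfEq (ker_toDiagonalRingMod d p).symm).trans
      (RingHom.quotientKerEquivOfSurjective (toDiagonalRingMod_surjective d p)))

lemma reductionEquiv_mk_mk (x : MvPolynomial (Fin s) ℤ) :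
    reductionEquiv d p (Ideal.Quotient.mk _ (Ideal.Quotient.mk _ x)) =
      toDiagonalRingMod d p x := rfl

/-- The presentation of the reduction by a polynomial ring over `𝔽_p`. -/
def presentation : MvPolynomial (Fin s) (ZMod p) →+* Reduction (DiagonalRing d) p :=
  (reductionEquiv d p).symm.toRingHom.comp (Ideal.Quotient.mk _)

lemma presentation_surjective : Function.Surjective (presentation d p) :=
  (reductionEquiv d p).symm.surjective.comp Ideal.Quotient.mk_surjective

lemma ker_presentation : RingHom.ker (presentation d p) =
    Ideal.span {∑ i, (X i : MvPolynomial (Fin s) (ZMod p)) ^ d i} := by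
  ext x
  rw [RingHom.mem_ker, presentation, RingHom.comp_apply]
  change (reductionEquiv d p).symm _ = 0 ↔ _
  rw [map_eq_zero_iff _ (reductionEquiv d p).symm.injective, Ideal.Quotient.eq_zero_iff_mem]

lemma presentation_X (i : Fin s) : presentation d p (X i) =
    Ideal.Quotient.mk _ (Ideal.Quotient.mk _ (X i)) := by
  refine (reductionEquiv d p).symm_apply_eq.2 ?_
  rw [reductionEquiv_mk_mk]
  simp [toDiagonalRingMod]

lemma reduceIdeal_varIdeal :
    reduceIdeal (varIdeal d) p = Ideal.span (Set.range fun i => presentation d p (X i)) := by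
  rw [reduceIdeal, varIdeal, Ideal.map_span, ← Set.range_comp]
  simp only [presentation_X]
  rfl

lemma comap_bracketPower [hp : Fact p.Prime] (hd : ∀ i, 0 < d i) (m : ℕ) :
    (bracketPower (reduceIdeal (varIdeal d) p) (p ^ m)).comap (presentation d p) =
      powIdeal (ZMod p) (fun _ => p ^ m) ⊔
        Ideal.span {∑ i, (X i : MvPolynomial (Fin s) (ZMod p)) ^ d i} := by
  -- The reduction must be nonzero to have characteristic p, which Frobenius requires.
  have hne : Ideal.span {∑ i, (X i : MvPolynomial (Fin s) (ZMod p)) ^ d i} ≠ ⊤ := by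
    intro h
    have hle : Ideal.span {∑ i, (X i : MvPolynomial (Fin s) (ZMod p)) ^ d i} ≤
        RingHom.ker (constantCoeff (σ := Fin s) (R := ZMod p)) := by
      rw [Ideal.span_singleton_le_iff_mem, RingHom.mem_ker, map_sum]
      exact Finset.sum_eq_zero fun i _ => by simp [(hd i).ne']
    rw [h, top_le_iff] at hle
    exact RingHom.ker_ne_top _ hle
  have : Nontrivial (DiagonalRingMod d p) := Ideal.Quotient.nontrivial_iff.2 hne
  have : Nontrivial (Reduction (DiagonalRing d) p) := (reductionEquiv d p).toEquiv.nontrivial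
  have hchar : CharP (Reduction (DiagonalRing d) p) p := by
    rw [CharP.charP_iff_prime_eq_zero hp.out, ← map_natCast (presentation d p)]
    have h0 : ((p : ℕ) : MvPolynomial (Fin s) (ZMod p)) = 0 := CharP.cast_eq_zero _ _
    exact (congrArg (presentation d p) h0).trans (map_zero _)
  -- As the extension of the ideal along the iterated Frobenius, the bracket power is generated by
  -- the powers of the generators alone.
  have h₁ : bracketPower (reduceIdeal (varIdeal d) p) (p ^ m) =
      (reduceIdeal (varIdeal d) p).map (iterateFrobenius (Reduction (DiagonalRing d) p) p m) := rfl
  have h₂ : bracketPower (reduceIdeal (varIdeal d) p) (p ^ m) =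
      (powIdeal (ZMod p) (fun _ => p ^ m)).map (presentation d p) := by
    rw [h₁, reduceIdeal_varIdeal, powIdeal, Ideal.map_span, Ideal.map_span, ← Set.range_comp,
      ← Set.range_comp]
    congr 2
    ext1 i
    simp [iterateFrobenius_def]
  rw [h₂, Ideal.comap_map_of_surjective' _ (presentation_surjective d p), ker_presentation]

lemma colength_bracketPower [hp : Fact p.Prime] (hd : ∀ i, 0 < d i) (m : ℕ) :
    colength (bracketPower (reduceIdeal (varIdeal d) p) (p ^ m)) =
      diagDim (ZMod p) (fun _ => p ^ m) d := by
  rw [← colength_comap_of_surjective _ (presentation_surjective d p), comap_bracketPower d p hd,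
    colength_eq_quotDim le_sup_left]
  rfl

lemma bracketPower_one {A : Type*} [CommRing A] (I : Ideal A) : bracketPower I 1 = I := by
  simp [bracketPower]

lemma colength_reduceIdeal [hp : Fact p.Prime] (hd : ∀ i, 0 < d i) :
    colength (reduceIdeal (varIdeal d) p) = 1 := by
  have h := colength_bracketPower d p hd 0
  rw [pow_zero, bracketPower_one] at h
  rw [h, diagDim, sup_eq_left.2]
  · simpa using quotDim_powIdeal (K := ZMod p) (fun _ : Fin s => 1)
  · rw [Ideal.span_singleton_le_iff_mem]
    exact Ideal.sum_mem _ fun i _ => X_pow_mem_powIdeal (hd i)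

end Reduction

/-! ### Assembling the theorem. -/

section Main

variable {s : ℕ} {d : Fin s → ℕ}

lemma dimNat_reduction (hs : 1 ≤ s) (hd : ∀ i, 0 < d i) (p : ℕ) [Fact p.Prime] :
    dimNat (Reduction (DiagonalRing d) p) = s - 1 := by
  obtain ⟨n, rfl⟩ := Nat.exists_eq_add_of_le' hs
  rw [dimNat, ringKrullDim_eq_of_ringEquiv (reductionEquiv d p), ringKrullDim_diagonal hd]
  rfl

lemma normalizedColength_eq (hs : 1 ≤ s) (hd : ∀ i, 0 < d i) (p : ℕ) [Fact p.Prime] :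
    normalizedColength p (reduceIdeal (varIdeal d) p) = diagRatio d p := by
  ext m
  rw [normalizedColength, colength_bracketPower d p hd, dimNat_reduction hs hd]
  rfl

lemma eventually_primesAtTop {P : ℕ → Prop} (h : ∀ p, p.Prime → P p) : ∀ᶠ p in primesAtTop, P p :=
  eventually_inf_principal.2 (Eventually.of_forall h)

end Main

end HilbertKunz

end

theorem mainTheorem3 (s : ℕ) (hs : 1 ≤ s) (d : Fin s → ℕ) (hd : ∀ i, 2 ≤ d i) :
    (∀ p : ℕ, p.Prime →
      HilbertKunz.HasHKMultiplicity p (HilbertKunz.reduceIdeal (HilbertKunz.varIdeal d) p)) ∧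
    ∃ L : ℝ,
      HilbertKunz.IsLimitHKMultiplicity (HilbertKunz.varIdeal d) L ∧
      (fun p : ℕ =>
        L - HilbertKunz.hkMultiplicity p (HilbertKunz.reduceIdeal (HilbertKunz.varIdeal d) p))
        =O[HilbertKunz.primesAtTop] (fun p : ℕ => 1 / (p : ℝ)) ∧
      (∀ n : ℕ, 1 ≤ n →
        (fun p : ℕ =>
          L - HilbertKunz.normalizedColength p
            (HilbertKunz.reduceIdeal (HilbertKunz.varIdeal d) p) n)
          =O[HilbertKunz.primesAtTop] (fun p : ℕ => 1 / (p : ℝ))) ∧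
      L = (∏ i, (d i : ℝ)) * HilbertKunz.g (fun i => 1 / (d i : ℝ)) := by
  open HilbertKunz in
  have hd0 : ∀ i, 0 < d i := fun i => by have := hd i; omega
  -- Neither `C₁` nor `C₂` depends on p, so the estimates below hold at every prime and give the
  -- O(1/p) terms directly.
  obtain ⟨C₁, hC₁, hlim⟩ := exists_tendsto_diagRatio hs hd
  obtain ⟨C₂, hC₂, hone⟩ := exists_abs_diagRatio_one_sub_le hs hd
  set L := (∏ i, (d i : ℝ)) * g (fun i => 1 / (d i : ℝ))
  have htends : ∀ (p : ℕ) [Fact p.Prime],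
      Tendsto (normalizedColength p (reduceIdeal (varIdeal d) p)) atTop
        (𝓝 (hkMultiplicity p (reduceIdeal (varIdeal d) p))) := fun p _ => by
    obtain ⟨e, he, -⟩ := hlim p
    rw [← normalizedColength_eq hs hd0] at he
    exact tendsto_nhds_limUnder ⟨e, he⟩
  have hbound : ∀ (p : ℕ) [Fact p.Prime] (m : ℕ), 1 ≤ m →
      |normalizedColength p (reduceIdeal (varIdeal d) p) m -
        hkMultiplicity p (reduceIdeal (varIdeal d) p)| ≤ C₁ / p := fun p hp m hm => by
    obtain ⟨e, he, hm'⟩ := hlim p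
    rw [← normalizedColength_eq hs hd0] at he hm'
    rw [tendsto_nhds_unique (htends p) he]
    have hp1 : (1 : ℝ) ≤ p := by exact_mod_cast hp.out.one_le
    refine (hm' m).trans ?_
    gcongr
    exact le_self_pow₀ hp1 (by omega)
  have hhk : ∀ (p : ℕ) [Fact p.Prime],
      |L - hkMultiplicity p (reduceIdeal (varIdeal d) p)| ≤ (C₁ + C₂) * (1 / p) := fun p _ => by
    have h₁ := hbound p 1 le_rfl
    have h₂ := hone p
    rw [← normalizedColength_eq hs hd0] at h₂
    rw [mul_one_div, add_div]
    rw [abs_le] at h₁ h₂ ⊢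
    constructor <;> linarith
  have hO : (fun p : ℕ => L - hkMultiplicity p (reduceIdeal (varIdeal d) p))
      =O[primesAtTop] (fun p : ℕ => 1 / (p : ℝ)) :=
    IsBigO.of_bound (C₁ + C₂) (eventually_primesAtTop fun p hp => by
      have := Fact.mk hp
      rw [Real.norm_eq_abs, Real.norm_eq_abs, abs_of_nonneg (by positivity : (0 : ℝ) ≤ 1 / p)]
      exact hhk p)
  have hhas : ∀ p : ℕ, p.Prime → HasHKMultiplicity p (reduceIdeal (varIdeal d) p) :=
    fun p hp => by
      have := Fact.mk hp
      refine ⟨fun m => ?_, htends p⟩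
      rw [colength_bracketPower d p hd0]
      obtain ⟨n, rfl⟩ := Nat.exists_eq_add_of_le' hs
      exact diagDim_const_ne_top hd0 _
  refine ⟨hhas, L, ⟨eventually_primesAtTop fun p hp => ?_, eventually_primesAtTop hhas, ?_⟩, hO,
    fun m hm => ?_, rfl⟩
  · have := Fact.mk hp
    rw [colength_reduceIdeal d p hd0]
    exact ⟨ENat.one_ne_top, one_ne_zero⟩
  · have h0 : Tendsto (fun p : ℕ => 1 / (p : ℝ)) primesAtTop (𝓝 0) :=
      tendsto_one_div_atTop_nhds_zero_nat.mono_left inf_le_left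
    have := (hO.trans_tendsto h0).const_sub L
    simpa using this
  · refine IsBigO.of_bound (C₁ + (C₁ + C₂)) (eventually_primesAtTop fun p hp => ?_)
    have := Fact.mk hp
    rw [Real.norm_eq_abs, Real.norm_eq_abs, abs_of_nonneg (by positivity : (0 : ℝ) ≤ 1 / p),
      add_mul]
    have h₁ := hbound p m hm
    have h₂ := hhk p
    rw [← mul_one_div] at h₁
    rw [abs_le] at h₁ h₂ ⊢
    constructor <;> linarith
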